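/- **Setting.** A *full passport* $\Xi_F=(S,\mathbf 1,W)$ is a nonempty finite set $S$ together with a function $W:S\to\mathbb R\setminus\{0\}$ such that $\sum_{s\in S}W(s)=0$. Put $N:=|\Xi_F|:=|S|$ (so $N\ge 2$). *Partitions.* $\mathfrak P(\Xi_F)$ is the set of partitions $\mathfrak p=\{S_1,\dots,S_n\}$ of $S$ into nonempty subsets with $\sum_{s\in S_i}W(s)=0$ for every $i$; write $|\mathfrak p|:=n$ and $X(\mathfrak p):=\prod_{i=1}^n(|S_i|-1)!$. The passport is *non-decomposable* if $\{S\}$ is the only element of $\mathfrak P(\Xi_F)$, equivalently if no nonempty proper subset of $S$ has total weight $0$. *Trees.* A *plane tree* is a finite tree given with a cyclic (counterclockwise) ordering of the edges around each vertex, i.e. the combinatorial datum of an embedding of the tree in the oriented plane up to orientation-preserving homeomorphism. A *labeled weighted bi-colored plane tree of passport $\Xi_F$* is a plane tree $(V,E)$ whose vertices are colored black or white so that each edge joins a black and a white vertex, with an edge weight function $W_E:E\to\mathbb R_{>0}$ and a bijection $L:V\to S$ such that, for every vertex $v$, $W(L(v))=\sum_{e\ni v}W_E(e)$ if $v$ is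 black and $W(L(v))=-\sum_{e\ni v}W_E(e)$ if $v$ is white. Two such trees are isomorphic if there is a graph isomorphism between them preserving the cyclic orderings, colors, edge weights and labels. $\mathrm{Tree}(\Xi_F)$ is the set of isomorphism classes. *Tree permutations.* For a permutation $\underline P=(s_1,\dots,s_N)$ of the elements of $S$ let $H_i:=\sum_{j=1}^iW(s_j)$ for $0\le i\le N$. $\underline P$ is a *tree permutation* if 1. $H_i\ne 0$ for all $1\le i\le N-1$; 2. whenever $1\le k<l\le N$ and $H_{k-1}=H_l>0$, then $\min\{H_k,\dots,H_{l-1}\}<H_l$; 3. whenever $1\le k<l\le N$ and $H_{k-1}=H_l<0$, then $\max\{H_k,\dots,H_{l-1}\}>H_l$. **Corollary.** Let $\Xi_F$ be a non-decomposable full passport. Then every permutation of the elements of $S$ is a tree permutation, and $$|\mathrm{Tree}(\Xi_F)|=\sum_{\mathfrak p\in\mathfrak P(\Xi_F)}(-1)^{|\mathfrak p|-1}\,(|\Xi_F|-1)^{|\mathfrak p|-2}\,X(\mathfrak p)=(|\Xi_F|-2)!.$$ -/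

import Mathlib

noncomputable section

/-- A passport `(S, λ, wt)` on the finite index set `S`: positive integer multiplicities `λ` and
nonzero real weights `wt` with `∑ λ(s) wt(s) = 0`; `S` is nonempty. -/
structure Passport (S : Type*) [Fintype S] where
  nonempty : Nonempty S
  mult : S → ℕ
  mult_pos : ∀ s, 0 < mult s
  wt : S → ℝ
  wt_ne_zero : ∀ s, wt s ≠ 0
  sum_eq_zero : ∑ s, (mult s : ℝ) * wt s = 0

/-- A weighted bi-colored plane tree.  The planar structure is recorded by the counterclockwise
cyclic order of the edges around every vertex (a tree with such a rotation system is the same as a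
tree embedded in the oriented plane, up to orientation-preserving homeomorphism).  The graph is
simple, so the edges at `v` are identified with the neighbours of `v`.
Vertices outside `black` are the white vertices. -/
structure WBPTree where
  V : Type
  [fintypeV : Fintype V]
  graph : SimpleGraph V
  isTree : graph.IsTree
  /-- sends an edge at `v` to the next one in counterclockwise order -/
  rot : ∀ v : V, Equiv.Perm (graph.neighborSet v)
  rot_isCycle : ∀ v : V, (rot v).IsCycleOn Set.univ
  black : Set V
  bicolored : ∀ u v : V, graph.Adj u v → (u ∈ black ↔ v ∉ black)
  weight : graph.edgeSet → ℝ
  weight_pos : ∀ e, 0 < weight e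

namespace WBPTree

attribute [instance] WBPTree.fintypeV

open Classical in
/-- The weight of a vertex: the sum of the weights of its edges, with sign `+` at a black vertex
and sign `-` at a white vertex. -/
def vertexWeight (T : WBPTree) (v : T.V) : ℝ :=
  (if v ∈ T.black then 1 else -1) *
    ∑ u : T.graph.neighborSet v, T.weight ⟨s(v, (u : T.V)), u.2⟩

end WBPTree

namespace Passport

variable {S : Type*} [Fintype S]

open Classical in
/-- The number `p` of black vertices. -/
def numBlack (Ξ : Passport S) : ℕ := ∑ s with 0 < Ξ.wt s, Ξ.mult s

open Classical in
/-- The number `q` of white vertices. -/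
def numWhite (Ξ : Passport S) : ℕ := ∑ s with Ξ.wt s < 0, Ξ.mult s

/-- `|Ξ| = p + q`, the total number of vertices. -/
def size (Ξ : Passport S) : ℕ := Ξ.numBlack + Ξ.numWhite

/-- A passport is full if all its multiplicities are `1`. -/
def IsFull (Ξ : Passport S) : Prop := ∀ s, Ξ.mult s = 1

/-- A labeled weighted bi-colored plane tree of passport `Ξ`. -/
structure LWBPTree (Ξ : Passport S) extends WBPTree where
  lab : V → S
  lab_surjective : Function.Surjective lab
  wt_lab : ∀ v, Ξ.wt (lab v) = toWBPTree.vertexWeight v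
  card_fiber : ∀ s, Nat.card {v : V // lab v = s} = Ξ.mult s

/-- Isomorphism of labeled weighted bi-colored plane trees: an isomorphism of graphs that respects
the counterclockwise cyclic order at each vertex, the colors, the edge weights and the labels. -/
def LWBPTree.Isomorphic {Ξ : Passport S} (T₁ T₂ : LWBPTree Ξ) : Prop :=
  ∃ φ : T₁.graph ≃g T₂.graph,
    (∀ (v : T₁.V) (u : T₁.graph.neighborSet v),
      φ.mapNeighborSet v (T₁.rot v u) = T₂.rot (φ v) (φ.mapNeighborSet v u)) ∧
    (∀ v, φ v ∈ T₂.black ↔ v ∈ T₁.black) ∧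
    (∀ e, T₂.weight (φ.mapEdgeSet e) = T₁.weight e) ∧
    (∀ v, T₂.lab (φ v) = T₁.lab v)

theorem LWBPTree.isomorphic_equivalence (Ξ : Passport S) :
    Equivalence (LWBPTree.Isomorphic (Ξ := Ξ)) where
  refl T := by
    refine ⟨SimpleGraph.Iso.refl, fun v u => ?_, fun v => Iff.rfl, fun e => ?_, fun v => rfl⟩
    · rfl
    · congr 1
      ext1
      simp
  symm := by
    rintro T₁ T₂ ⟨φ, hr, hb, hw, hl⟩
    refine ⟨φ.symm, ?_, fun v => ?_, fun e => ?_, fun v => ?_⟩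
    · intro v u
      obtain ⟨v, rfl⟩ := φ.surjective v
      obtain ⟨u, rfl⟩ := (φ.mapNeighborSet v).surjective u
      rw [← hr v u]
      have key : ∀ (w : T₁.V) (hw : w = v) (x : T₁.graph.neighborSet v)
          (y : T₁.graph.neighborSet w), (y : T₁.V) = x →
          ((T₁.rot w y : T₁.graph.neighborSet w) : T₁.V) = T₁.rot v x := by
        rintro w rfl x y hxy
        rw [Subtype.ext hxy]
      apply Subtype.ext
      rw [key _ (φ.symm_apply_apply v) u _ (φ.symm_apply_apply (u : T₁.V))]
      exact φ.symm_apply_apply _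
    · rw [← hb, φ.apply_symm_apply]
    · rw [← hw]
      congr 1
      exact φ.mapEdgeSet.apply_symm_apply e
    · rw [← hl, φ.apply_symm_apply]
  trans := by
    rintro T₁ T₂ T₃ ⟨φ, hr, hb, hw, hl⟩ ⟨ψ, hr', hb', hw', hl'⟩
    refine ⟨φ.trans ψ, fun v u => ?_, fun v => ?_, fun e => ?_, fun v => ?_⟩
    · have h1 := congrArg (ψ.mapNeighborSet (φ v)) (hr v u)
      exact h1.trans (hr' (φ v) (φ.mapNeighborSet v u))
    · exact (hb' (φ v)).trans (hb v)
    · rw [← hw, ← hw']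
      congr 1
      ext1
      simp [SimpleGraph.Iso.mapEdgeSet, SimpleGraph.Hom.mapEdgeSet, Sym2.map_map]
    · exact (hl' (φ v)).trans (hl v)

/-- `Tree(Ξ)`: the isomorphism classes of labeled weighted bi-colored plane trees of passport
`Ξ`. -/
def Tree (Ξ : Passport S) : Type _ :=
  Quotient (⟨LWBPTree.Isomorphic, LWBPTree.isomorphic_equivalence Ξ⟩ : Setoid (LWBPTree Ξ))

section Partitions

variable [DecidableEq S]

open Classical in
/-- The set of partitions of a full passport `Ξ`: partitions of `S` into nonempty parts such that
the restriction of `Ξ` to each part is again a passport. -/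
def partitions (Ξ : Passport S) : Finset (Finpartition (Finset.univ : Finset S)) :=
  Finset.univ.filter fun 𝔭 => ∀ A ∈ 𝔭.parts, ∑ s ∈ A, (Ξ.mult s : ℝ) * Ξ.wt s = 0

/-- The trivial partition of `Ξ` into one part. -/
def trivialPartition (Ξ : Passport S) : Finpartition (Finset.univ : Finset S) :=
  Finpartition.indiscrete (Finset.univ_nonempty_iff.mpr Ξ.nonempty).ne_empty

/-- `Ξ` is non-decomposable if the trivial partition is its only partition. -/
def IsNonDecomposable (Ξ : Passport S) : Prop := Ξ.partitions = {Ξ.trivialPartition}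

/-- `X(𝔭) = ∏ (|Sᵢ| - 1)!` over the parts `Sᵢ` of the partition `𝔭`. -/
def X (𝔭 : Finpartition (Finset.univ : Finset S)) : ℕ :=
  ∏ A ∈ 𝔭.parts, (A.card - 1).factorial

end Partitions

/-- The set of permutations `(s₁, …, s_N)` of the elements of `S`, `N = |S|`.  The entry `sᵢ` is
the value at the element `i - 1` of `Fin N`. -/
abbrev Permutation (_ : Passport S) : Type _ := Fin (Fintype.card S) ≃ S

/-- The cumulative sum `H_i = wt(s₁) + ⋯ + wt(s_i)`, for `0 ≤ i ≤ N`. -/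
def cumSum (Ξ : Passport S) (P : Ξ.Permutation) (i : ℕ) : ℝ :=
  ∑ j : Fin (Fintype.card S) with j.val < i, Ξ.wt (P j)

/-- Tree permutations, in terms of the cumulative sums. -/
structure IsTreePermutation (Ξ : Passport S) (P : Ξ.Permutation) : Prop where
  ne_zero : ∀ i : ℕ, 1 ≤ i → i ≤ Fintype.card S - 1 → Ξ.cumSum P i ≠ 0
  min_lt : ∀ (k l : ℕ) (_ : 1 ≤ k) (hkl : k < l) (_ : l ≤ Fintype.card S),
    Ξ.cumSum P (k - 1) = Ξ.cumSum P l → 0 < Ξ.cumSum P l →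
      (Finset.Icc k (l - 1)).inf' (Finset.nonempty_Icc.mpr (Nat.le_sub_one_of_lt hkl))
        (Ξ.cumSum P) < Ξ.cumSum P l
  lt_max : ∀ (k l : ℕ) (_ : 1 ≤ k) (hkl : k < l) (_ : l ≤ Fintype.card S),
    Ξ.cumSum P (k - 1) = Ξ.cumSum P l → Ξ.cumSum P l < 0 →
      Ξ.cumSum P l <
        (Finset.Icc k (l - 1)).sup' (Finset.nonempty_Icc.mpr (Nat.le_sub_one_of_lt hkl))
          (Ξ.cumSum P)

end Passport

end

/-! ### Abstract contour codes and vertex positions. -/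

noncomputable section

/-! Write N for the number of vertices. Mark an edge of a tree and follow the contour once around
from it, so that each of the N - 1 edges occurs once. List a black vertex at its first visit and a
white one at its last. The cumulative sum at a cut of this order is the total weight of the edges
whose black end is listed before the cut and whose white end is not (`partialSum_eq`), so all proper
cumulative sums are positive.

The order determines the marked tree. By planarity (`noncrossing`), the position of the black end of
the k-th edge is the last index before k + 1 where the cumulative sum lies below its value at k + 1.
White ends follow by reversing the contour (`black_eq_of_pos_eq`, `white_eq_of_pos_eq`). The two
sequences of ends fix the plane tree, and the weights are then forced (`isomorphic_of_code_eq`,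
`flow_unique`).

Every order with positive proper sums arises. Non-decomposability makes the cumulative sums
distinct, apart from the two zeros at the ends. Cut the region below the path into horizontal
strips, each joining an up-step to a later down-step. Steps are the vertices, strips the edges and
strip widths the weights (`arcGraph_isTree`, `tree_vertexWeight`), and the contour runs through the
strips from left to right (`contour_edge`).

By the cycle lemma, exactly one of the N rotations of an order has positive proper sums, which
leaves (N - 1)! such orders (`card_positiveOrder`). Distinct labels exclude nontrivial
automorphisms, so each tree carries N - 1 distinct marks, and division gives (N - 2)!. Distinctness
of the sums also makes the last two conditions on tree permutations vacuous, and the sum over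
partitions has a single term. -/

/-- The sequence of (black end, white end) pairs met by the contour of a plane bipartite tree with
`n` edges. -/
structure ContourCode {S : Type*} (n : ℕ) (β ω : ℕ → S) : Prop where
  n_pos : 0 < n
  link : ∀ m, m + 1 < n → ∃ f < n, ω f = ω m ∧ β f = β (m + 1)
  link_last : ∃ f < n, ω f = ω (n - 1) ∧ β f = β 0
  disj : ∀ a < n, ∀ b < n, β a ≠ ω b
  cover : ∀ s, ∃ k < n, β k = s ∨ ω k = s
  conn : ∀ A : Set ℕ, (∃ a < n, a ∈ A) →
    (∀ a < n, ∀ b < n, a ∈ A → (β a = β b ∨ ω a = ω b) → b ∈ A) → ∀ k < n, k ∈ A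
  cut : ∀ x < n, ∃ D : Set ℕ, x ∈ D ∧ (∀ a < n, ∀ b < n, a ∈ D → ω a = ω b → b ∈ D) ∧
    (∀ a < n, ∀ b < n, a ∈ D → a ≠ x → β a = β b → b ∈ D ∧ b ≠ x)

open Classical in
/-- Positive edge weights `W` with prescribed signed vertex sums `wt`. -/
structure IsFlow {S : Type*} (n : ℕ) (β ω : ℕ → S) (W : ℕ → ℝ) (wt : S → ℝ) : Prop where
  pos : ∀ k < n, 0 < W k
  sum : ∀ s, wt s = ∑ k ∈ Finset.range n with β k = s, W k - ∑ k ∈ Finset.range n with ω k = s, W k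

open Classical in
/-- The position of a vertex in the contour order: a black vertex is listed at its first visit,
a white one at its last visit. -/
def contourPos {S : Type*} (n : ℕ) (β ω : ℕ → S) (s : S) : ℕ :=
  if h : ∃ k, k < n ∧ β k = s then Nat.find h
  else ((Finset.range n).filter (fun k => ω k = s)).sup (· + 1)

namespace ContourCode

variable {S : Type*} {n : ℕ} {β ω : ℕ → S}

/-- Reading the contour backwards with the colors exchanged turns last visits of white vertices into
first visits of black ones. Statements about black ends thus transfer to white ends. -/
theorem dual (h : ContourCode n β ω) :
    ContourCode n (fun k => ω (n - 1 - k)) (fun k => β (n - 1 - k)) where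
  n_pos := h.n_pos
  link m hm := by
    obtain ⟨f, hf, h1, h2⟩ := h.link (n - 1 - (m + 1)) (by omega)
    refine ⟨n - 1 - f, by omega, ?_, ?_⟩
    · rw [show n - 1 - (n - 1 - f) = f by omega, h2]; congr 1; omega
    · rw [show n - 1 - (n - 1 - f) = f by omega, h1]
  link_last := by
    obtain ⟨f, hf, h1, h2⟩ := h.link_last
    have := h.n_pos
    refine ⟨n - 1 - f, by omega, ?_, ?_⟩
    · rw [show n - 1 - (n - 1 - f) = f by omega, h2]; congr 1; omega
    · rw [show n - 1 - (n - 1 - f) = f by omega, h1]; simp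
  disj a ha b hb := (h.disj _ (by omega) _ (by omega)).symm
  cover s := by
    obtain ⟨k, hk, hs⟩ := h.cover s
    refine ⟨n - 1 - k, by omega, ?_⟩
    rw [show n - 1 - (n - 1 - k) = k by omega]; exact hs.symm
  conn A hA hsat k hk := by
    have := h.conn {a | n - 1 - a ∈ A} ?_ ?_ (n - 1 - k) (by omega)
    · simpa [show n - 1 - (n - 1 - k) = k by omega] using this
    · obtain ⟨a, ha, haA⟩ := hA
      exact ⟨n - 1 - a, by omega, by simpa [show n - 1 - (n - 1 - a) = a by omega] using haA⟩
    · intro a ha b hb haA hab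
      refine hsat _ (by omega) _ (by omega) haA ?_
      rw [show n - 1 - (n - 1 - a) = a by omega, show n - 1 - (n - 1 - b) = b by omega]
      exact hab.symm
  cut x hx := by
    obtain ⟨D, hxD, hω, hβ⟩ := h.cut (n - 1 - x) (by omega)
    -- The other side of the cut: the complement of the reversed `D`, together with `x` itself.
    refine ⟨{a | n - 1 - a ∈ D → a = x}, fun _ => rfl, ?_, ?_⟩
    · intro a ha b hb haD hab hbD
      by_contra hbx
      have := hβ (n - 1 - b) (by omega) (n - 1 - a) (by omega) hbD (by omega) hab.symm
      exact this.2 (by rw [haD this.1])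
    · intro a ha b hb haD hax hab
      have hb' : n - 1 - b ∉ D := fun hbD =>
        hax (haD (hω (n - 1 - b) (by omega) (n - 1 - a) (by omega) hbD hab.symm))
      refine ⟨fun hbD => absurd hbD hb', ?_⟩
      rintro rfl
      exact hb' hxD

/-- The edges at the black vertex `β k` cut the tree into branches, and the contour traverses each
branch `D u` in one cyclic interval starting at `u`. Two visits to `β k` therefore enclose whole
branches, and a vertex other than `β k` has all its edges in one branch. -/
theorem noncrossing (h : ContourCode n β ω) {p z k z' : ℕ} (hpz : p ≤ z) (hzk : z < k) (hk : k < n)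
    (hz' : z' < n) (hpk : β p = β k) (hzz : ω z = ω z' ∨ (β z = β z' ∧ β z ≠ β k)) :
    p ≤ z' ∧ z' < k := by
  choose! D hself hω hβ using h.cut
  -- By connectivity the branches at `β k` exhaust the edges.
  obtain ⟨u, hu, huk, hzD⟩ : ∃ u < n, β u = β k ∧ z ∈ D u := by
    refine h.conn {z | ∃ u < n, β u = β k ∧ z ∈ D u} ⟨k, hk, k, hk, rfl, hself k hk⟩ ?_ z (by omega)
    rintro a ha b hb ⟨u, hu, huk, haD⟩ (hab | hab)
    · by_cases hau : a = u
      · subst hau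
        exact ⟨b, hb, hab ▸ huk, hself b hb⟩
      · exact ⟨u, hu, huk, (hβ u hu a ha b hb haD hau hab).1⟩
    · exact ⟨u, hu, huk, hω u hu a ha b hb haD hab⟩
  have only : ∀ t < n, t ∈ D u → β t = β k → t = u := fun t ht htD htk => by
    by_contra htu
    exact (hβ u hu t ht u hu htD htu (htk.trans huk.symm)).2 rfl
  have pred : ∀ m, m + 1 < n → m + 1 ∈ D u → m + 1 ≠ u → m ∈ D u := fun m hm hmD hmu => by
    obtain ⟨f, hf, h1, h2⟩ := h.link m hm
    exact hω u hu f hf m (by omega) (hβ u hu _ hm f hf hmD hmu h2.symm).1 h1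
  have pred_zero : 0 ∈ D u → 0 ≠ u → n - 1 ∈ D u := fun hmD hmu => by
    obtain ⟨f, hf, h1, h2⟩ := h.link_last
    exact hω u hu f hf _ (by omega) (hβ u hu _ h.n_pos f hf hmD hmu h2.symm).1 h1
  -- Walking back from `y` one cannot leave the branch before reaching its root edge `u`; the
  -- hypothesis on `u + d` says that `u` has not been passed.
  have arc : ∀ d y, y < n → y ∈ D u → (u ≤ y → u + d ≤ y) → d ≤ y → y - d ∈ D u := by
    intro d
    induction d with
    | zero => intro y _ hy _ _; simpa using hy
    | succ d ih =>
      intro y hyn hy hd hdy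
      have h1 := ih y hyn hy (fun h => by have := hd h; omega) (by omega)
      refine pred _ (by omega) ?_ ?_
      · rwa [show y - (d + 1) + 1 = y - d by omega]
      · intro h'
        by_cases huy : u ≤ y
        · have := hd huy; omega
        · omega
  have arc_le : ∀ t y, y < n → y ∈ D u → u ≤ y → u ≤ t → t ≤ y → t ∈ D u := by
    intro t y hyn hy huy hut hty
    have := arc (y - t) y hyn hy (by omega) (by omega)
    rwa [show y - (y - t) = t by omega] at this
  have arc_low : ∀ t y, y < n → y ∈ D u → y < u → t ≤ y → t ∈ D u := by
    intro t y hyn hy huy hty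
    have := arc (y - t) y hyn hy (by omega) (by omega)
    rwa [show y - (y - t) = t by omega] at this
  have arc_wrap : ∀ t y, y < n → y ∈ D u → y < u → u ≤ t → t < n → t ∈ D u := by
    intro t y hyn hy huy hut htn
    exact arc_le t (n - 1) (by omega)
      (pred_zero (arc_low 0 y hyn hy huy (by omega)) (by omega)) (by omega) hut (by omega)
  have huz : u ≤ z := by
    by_contra hlt
    have := only p (by omega) (arc_low p z (by omega) hzD (by omega) hpz) hpk
    omega
  have hz'D : z' ∈ D u := by
    rcases hzz with hzz | ⟨hzz, hne⟩
    · exact hω u hu z (by omega) z' hz' hzD hzz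
    · exact (hβ u hu z (by omega) z' hz' hzD (by rintro rfl; exact hne huk) hzz).1
  have huz' : u ≤ z' := by
    by_contra hlt
    have := only k hk (arc_wrap k z' hz' hz'D (by omega) (by omega) hk) rfl
    omega
  have hpu : p ≤ u := by
    by_contra hlt
    have := only p (by omega) (arc_le p z (by omega) hzD huz (by omega) hpz) hpk
    omega
  refine ⟨by omega, ?_⟩
  by_contra hlt
  have := only k hk (arc_le k z' hz' hz'D huz' (by omega) (by omega)) rfl
  omega

theorem pos_black_le {k : ℕ} (hk : k < n) : contourPos n β ω (β k) ≤ k := by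
  classical
  have : ∃ m, m < n ∧ β m = β k := ⟨k, hk, rfl⟩
  rw [contourPos, dif_pos this]
  exact Nat.find_min' this ⟨hk, rfl⟩

theorem pos_black_spec {k : ℕ} (hk : k < n) :
    contourPos n β ω (β k) < n ∧ β (contourPos n β ω (β k)) = β k := by
  classical
  have : ∃ m, m < n ∧ β m = β k := ⟨k, hk, rfl⟩
  rw [contourPos, dif_pos this]
  exact Nat.find_spec this

theorem lt_pos_white (h : ContourCode n β ω) {k : ℕ} (hk : k < n) :
    k < contourPos n β ω (ω k) := by
  classical
  have : ¬ ∃ m, m < n ∧ β m = ω k := fun ⟨m, hm, hmk⟩ => h.disj m hm k hk hmk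
  rw [contourPos, dif_neg this]
  exact Nat.lt_of_succ_le (Finset.le_sup (f := fun m => m + 1) (by simpa using hk))

theorem pos_white_spec (h : ContourCode n β ω) {k : ℕ} (hk : k < n) :
    contourPos n β ω (ω k) - 1 < n ∧ ω (contourPos n β ω (ω k) - 1) = ω k := by
  classical
  have : ¬ ∃ m, m < n ∧ β m = ω k := fun ⟨m, hm, hmk⟩ => h.disj m hm k hk hmk
  rw [contourPos, dif_neg this]
  obtain ⟨q, hq, hq'⟩ := Finset.exists_mem_eq_sup
    ((Finset.range n).filter (fun m => ω m = ω k)) ⟨k, by simpa using hk⟩ (· + 1)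
  rw [hq']
  simpa using hq

/-- The position function is determined by its extremality. -/
theorem pos_unique (h : ContourCode n β ω) (f : S → ℕ) (hb : ∀ k < n, f (β k) ≤ k)
    (hb' : ∀ k < n, f (β k) < n ∧ β (f (β k)) = β k) (hw : ∀ k < n, k < f (ω k))
    (hw' : ∀ k < n, f (ω k) - 1 < n ∧ ω (f (ω k) - 1) = ω k) : contourPos n β ω = f := by
  funext s
  obtain ⟨k, hk, rfl | rfl⟩ := h.cover s
  · obtain ⟨h1, h2⟩ := hb' k hk
    obtain ⟨h3, h4⟩ := pos_black_spec (ω := ω) (β := β) hk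
    have h5 := pos_black_le (ω := ω) (β := β) h1
    have h6 := hb _ h3
    rw [h2] at h5; rw [h4] at h6
    omega
  · obtain ⟨h1, h2⟩ := hw' k hk
    obtain ⟨h3, h4⟩ := h.pos_white_spec hk
    have h5 := h.lt_pos_white h1
    have h6 := hw _ h3
    rw [h2] at h5; rw [h4] at h6
    omega

theorem pos_dual (h : ContourCode n β ω) :
    contourPos n (fun k => ω (n - 1 - k)) (fun k => β (n - 1 - k)) =
      fun s => n - contourPos n β ω s := by
  refine h.dual.pos_unique _ ?_ ?_ ?_ ?_
  · intro k hk
    have := h.lt_pos_white (show n - 1 - k < n by omega)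
    omega
  · intro k hk
    have h1 := h.lt_pos_white (show n - 1 - k < n by omega)
    obtain ⟨h2, h3⟩ := h.pos_white_spec (show n - 1 - k < n by omega)
    refine ⟨by omega, ?_⟩
    rw [← h3]; congr 1; rw [h3]; omega
  · intro k hk
    have := pos_black_le (β := β) (ω := ω) (show n - 1 - k < n by omega)
    omega
  · intro k hk
    have h1 := pos_black_le (β := β) (ω := ω) (show n - 1 - k < n by omega)
    obtain ⟨h2, h3⟩ := pos_black_spec (β := β) (ω := ω) (show n - 1 - k < n by omega)
    refine ⟨by omega, ?_⟩
    rw [← h3]; congr 1; rw [h3]; omega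

/-- If a last visit of a white vertex were immediately followed by a first visit of a black one, the
edge given by `link`, which joins these two vertices, would have to occur both no later than the
former and no earlier than the latter. -/
theorem pos_black_ne_pos_white (h : ContourCode n β ω) {a b : ℕ} (ha : a < n) (hb : b < n) :
    contourPos n β ω (β a) ≠ contourPos n β ω (ω b) := by
  intro hab
  obtain ⟨h1, h2⟩ := pos_black_spec (β := β) (ω := ω) ha
  obtain ⟨h3, h4⟩ := h.pos_white_spec hb
  have h5 := h.lt_pos_white hb
  obtain ⟨f, hf, hfω, hfβ⟩ := h.link (contourPos n β ω (ω b) - 1) (by omega)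
  have h6 := h.lt_pos_white hf
  have h7 := pos_black_le (β := β) (ω := ω) hf
  rw [hfω, h4] at h6
  rw [hfβ, show contourPos n β ω (ω b) - 1 + 1 = contourPos n β ω (β a) by omega, h2] at h7
  omega

theorem pos_injective (h : ContourCode n β ω) : Function.Injective (contourPos n β ω) := by
  intro s t hst
  obtain ⟨a, ha, rfl | rfl⟩ := h.cover s <;> obtain ⟨b, hb, rfl | rfl⟩ := h.cover t
  · rw [← (pos_black_spec (β := β) (ω := ω) ha).2, ← (pos_black_spec (β := β) (ω := ω) hb).2, hst]
  · exact absurd hst (h.pos_black_ne_pos_white ha hb)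
  · exact absurd hst.symm (h.pos_black_ne_pos_white hb ha)
  · rw [← (h.pos_white_spec ha).2, ← (h.pos_white_spec hb).2, hst]

theorem pos_le (h : ContourCode n β ω) (s : S) : contourPos n β ω s ≤ n := by
  obtain ⟨a, ha, rfl | rfl⟩ := h.cover s
  · exact (pos_black_spec ha).1.le
  · have := (h.pos_white_spec ha).1; omega

/-! ### Flows, partial sums, and recovery of the code from the positions. -/

variable {W : ℕ → ℝ} {wt : S → ℝ}

/-- The difference of two flows sums to zero around each vertex. One side `D` of the cut at `x` is a
union of white stars, while `D` without `x` is a union of black stars; subtracting the two vanishing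
sums isolates the difference at `x`. -/
theorem flow_unique (h : ContourCode n β ω) {W' : ℕ → ℝ} (hW : IsFlow n β ω W wt)
    (hW' : IsFlow n β ω W' wt) {x : ℕ} (hx : x < n) : W x = W' x := by
  classical
  set d : ℕ → ℝ := fun k => W k - W' k with hd
  have key : ∀ s, ∑ k ∈ Finset.range n with β k = s, d k = ∑ k ∈ Finset.range n with ω k = s, d k := by
    intro s
    have h1 := hW.sum s
    rw [hW'.sum s] at h1
    simp only [hd, Finset.sum_sub_distrib]
    linarith
  have hβ0 : ∀ a < n, ∑ k ∈ Finset.range n with β k = β a, d k = 0 := fun a ha => by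
    rw [key, Finset.filter_false_of_mem, Finset.sum_empty]
    exact fun b hb hab => h.disj a ha b (Finset.mem_range.1 hb) hab.symm
  have hω0 : ∀ a < n, ∑ k ∈ Finset.range n with ω k = ω a, d k = 0 := fun a ha => by
    rw [← key, Finset.filter_false_of_mem, Finset.sum_empty]
    exact fun b hb hab => h.disj b (Finset.mem_range.1 hb) a ha hab
  have sat : ∀ (g : ℕ → S) (A : Finset ℕ), A ⊆ Finset.range n →
      (∀ a < n, ∑ k ∈ Finset.range n with g k = g a, d k = 0) →
      (∀ a ∈ A, ∀ b < n, g a = g b → b ∈ A) → ∑ k ∈ A, d k = 0 := by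
    intro g A hA h0 hs
    rw [← Finset.sum_fiberwise_of_maps_to (g := g) (t := A.image g)
      (fun a ha => Finset.mem_image_of_mem g ha)]
    refine Finset.sum_eq_zero fun s hsA => ?_
    obtain ⟨a, ha, rfl⟩ := Finset.mem_image.1 hsA
    rw [← h0 a (Finset.mem_range.1 (hA ha))]
    refine Finset.sum_congr ?_ fun _ _ => rfl
    ext b
    simp only [Finset.mem_filter, Finset.mem_range]
    exact ⟨fun hb => ⟨Finset.mem_range.1 (hA hb.1), hb.2⟩,
      fun hb => ⟨hs a ha b hb.1 hb.2.symm, hb.2⟩⟩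
  obtain ⟨D, hxD, hω, hβ⟩ := h.cut x hx
  have e1 := sat ω ((Finset.range n).filter (· ∈ D)) (Finset.filter_subset _ _) hω0 (by
    intro a ha b hb hab
    simp only [Finset.mem_filter, Finset.mem_range] at ha ⊢
    exact ⟨hb, hω a ha.1 b hb ha.2 hab⟩)
  have e2 := sat β (((Finset.range n).filter (· ∈ D)).erase x)
    ((Finset.erase_subset _ _).trans (Finset.filter_subset _ _)) hβ0 (by
    intro a ha b hb hab
    simp only [Finset.mem_erase, Finset.mem_filter, Finset.mem_range] at ha ⊢
    have := hβ a ha.2.1 b hb ha.2.2 ha.1 hab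
    exact ⟨this.2, hb, this.1⟩)
  have e3 := Finset.add_sum_erase ((Finset.range n).filter (· ∈ D)) d
    (show x ∈ _ by simpa using ⟨hx, hxD⟩)
  have : d x = 0 := by linarith
  simpa [hd, sub_eq_zero] using this

theorem _root_.IsFlow.congr {β' ω' : ℕ → S} (h : IsFlow n β' ω' W wt) (hb : ∀ k < n, β k = β' k) (hw : ∀ k < n, ω k = ω' k) :
    IsFlow n β ω W wt := by
  classical
  refine ⟨h.pos, fun s => ?_⟩
  rw [h.sum s]
  congr 1
  · refine Finset.sum_congr (Finset.filter_congr fun k hk => ?_) fun _ _ => rfl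
    rw [hb k (Finset.mem_range.1 hk)]
  · refine Finset.sum_congr (Finset.filter_congr fun k hk => ?_) fun _ _ => rfl
    rw [hw k (Finset.mem_range.1 hk)]

theorem _root_.IsFlow.dual (hW : IsFlow n β ω W wt) :
    IsFlow n (fun k => ω (n - 1 - k)) (fun k => β (n - 1 - k)) (fun k => W (n - 1 - k))
      (fun s => - wt s) := by
  classical
  have e : ∀ (g : ℕ → S) (s : S), ∑ k ∈ Finset.range n with g (n - 1 - k) = s, W (n - 1 - k) =
      ∑ k ∈ Finset.range n with g k = s, W k := by
    intro g s
    rw [Finset.sum_filter, Finset.sum_filter, ← Finset.sum_range_reflect]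
    refine Finset.sum_congr rfl fun k hk => ?_
    rw [Finset.mem_range] at hk
    rw [show n - 1 - (n - 1 - k) = k by omega]
  refine ⟨fun k hk => hW.pos _ (by omega), fun s => ?_⟩
  rw [e, e, hW.sum]
  ring

variable [Fintype S]

/-- The sum of the weights of the vertices at positions less than `k`. -/
def partialSum (wt : S → ℝ) (pos : S → ℕ) (k : ℕ) : ℝ := ∑ s with pos s < k, wt s

/-- Each edge adds its weight at its black end and removes it at its white end, which is listed
later. Only edges straddling the cut survive. -/
theorem partialSum_eq (h : ContourCode n β ω) (hW : IsFlow n β ω W wt) (k : ℕ) :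
    partialSum wt (contourPos n β ω) k =
      ∑ f ∈ Finset.range n with contourPos n β ω (β f) < k ∧ k ≤ contourPos n β ω (ω f), W f := by
  classical
  rw [partialSum, Finset.sum_congr rfl fun s _ => hW.sum s, Finset.sum_sub_distrib]
  have e : ∀ g : ℕ → S, ∑ s with contourPos n β ω s < k, ∑ f ∈ Finset.range n with g f = s, W f =
      ∑ f ∈ Finset.range n with contourPos n β ω (g f) < k, W f := by
    intro g
    have := Finset.sum_fiberwise_eq_sum_filter (Finset.range n)
      (Finset.univ.filter fun s => contourPos n β ω s < k) g W
    simp only [Finset.mem_filter, Finset.mem_univ, true_and] at this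
    convert this
  rw [e, e, Finset.sum_filter, Finset.sum_filter, Finset.sum_filter, ← Finset.sum_sub_distrib]
  refine Finset.sum_congr rfl fun f hf => ?_
  have h1 := h.lt_pos_white (Finset.mem_range.1 hf)
  have h2 := pos_black_le (β := β) (ω := ω) (Finset.mem_range.1 hf)
  by_cases h3 : contourPos n β ω (β f) < k <;> by_cases h4 : contourPos n β ω (ω f) < k
  · simp [h3, h4]
  · simp [h3, h4, not_lt.1 h4]
  · omega
  · simp [h3, h4]

theorem partialSum_pos (h : ContourCode n β ω) (hW : IsFlow n β ω W wt) {k : ℕ} (hk : k < n) :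
    0 < partialSum wt (contourPos n β ω) (k + 1) := by
  rw [h.partialSum_eq hW]
  refine Finset.sum_pos (fun f hf => hW.pos f ?_) ⟨k, ?_⟩
  · exact Finset.mem_range.1 (Finset.mem_filter.1 hf).1
  · have h1 := h.lt_pos_white hk
    have h2 := pos_black_le (β := β) (ω := ω) hk
    simp only [Finset.mem_filter, Finset.mem_range]
    omega

theorem partialSum_lt_of_imp (h : ContourCode n β ω) (hW : IsFlow n β ω W wt) {k l x : ℕ}
    (hkl : ∀ f < n, contourPos n β ω (β f) < k → k ≤ contourPos n β ω (ω f) →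
      contourPos n β ω (β f) < l ∧ l ≤ contourPos n β ω (ω f))
    (hx : x < n) (hxl : contourPos n β ω (β x) < l ∧ l ≤ contourPos n β ω (ω x))
    (hxk : ¬ (contourPos n β ω (β x) < k ∧ k ≤ contourPos n β ω (ω x))) :
    partialSum wt (contourPos n β ω) k < partialSum wt (contourPos n β ω) l := by
  rw [h.partialSum_eq hW, h.partialSum_eq hW]
  refine Finset.sum_lt_sum_of_subset (i := x) ?_ ?_ ?_ (hW.pos x hx) ?_
  · intro f
    simp only [Finset.mem_filter, Finset.mem_range]
    exact fun ⟨h1, h2, h3⟩ => ⟨h1, hkl f h1 h2 h3⟩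
  · simpa only [Finset.mem_filter, Finset.mem_range] using ⟨hx, hxl⟩
  · simp only [Finset.mem_filter, Finset.mem_range]
    exact fun h' => hxk h'.2
  · intro f hf _
    exact (hW.pos f (Finset.mem_range.1 (Finset.mem_filter.1 hf).1)).le

/-- By `noncrossing`, an edge straddling the cut at the first visit of `β k` still straddles the cut
at `k + 1`, and edge `k` straddles only the second. -/
theorem partialSum_pos_black_lt (h : ContourCode n β ω) (hW : IsFlow n β ω W wt) {k : ℕ}
    (hk : k < n) : partialSum wt (contourPos n β ω) (contourPos n β ω (β k)) <
      partialSum wt (contourPos n β ω) (k + 1) := by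
  have hpk := pos_black_le (β := β) (ω := ω) hk
  have hp := pos_black_spec (β := β) (ω := ω) hk
  have hωk := h.lt_pos_white hk
  refine h.partialSum_lt_of_imp hW (x := k) ?_ hk (by omega) (by omega)
  intro f hf h1 h2
  refine ⟨by omega, ?_⟩
  by_contra hlt
  have h3 := h.pos_black_ne_pos_white hk hf
  have h4 := h.pos_white_spec hf
  have h5 := h.noncrossing (p := contourPos n β ω (β k)) (z := contourPos n β ω (ω f) - 1) (k := k)
    (z' := f) (by omega) (by omega) hk hf hp.2 (Or.inl h4.2)
  have h6 := pos_black_spec (β := β) (ω := ω) hf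
  have h7 := h.noncrossing (z' := contourPos n β ω (β f)) h5.1 h5.2 hk h6.1 hp.2
    (Or.inr ⟨h6.2.symm, fun h' => by rw [h'] at h1; omega⟩)
  omega

/-- An edge straddling the cut at `k + 1` already straddles the one at `m`, and edge `m - 1` is lost
in between because its white end is exhausted before visit `k`. With `partialSum_pos_black_lt`, this
identifies the position of `β k` from the path of partial sums alone. -/
theorem partialSum_lt_of_pos_black_lt (h : ContourCode n β ω) (hW : IsFlow n β ω W wt) {k m : ℕ}
    (hk : k < n) (hm : contourPos n β ω (β k) < m) (hmk : m ≤ k) :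
    partialSum wt (contourPos n β ω) (k + 1) < partialSum wt (contourPos n β ω) m := by
  have hp := pos_black_spec (β := β) (ω := ω) hk
  have hm1 := h.lt_pos_white (show m - 1 < n by omega)
  have hm2 := pos_black_le (β := β) (ω := ω) (show m - 1 < n by omega)
  have hm3 := h.pos_white_spec (show m - 1 < n by omega)
  refine h.partialSum_lt_of_imp hW (x := m - 1) ?_ (by omega) (by omega) ?_
  · intro f hf h1 h2
    refine ⟨?_, by omega⟩
    by_contra hlt
    have h6 := pos_black_spec (β := β) (ω := ω) hf
    have hne : β f ≠ β k := fun h' => by rw [h'] at hlt; omega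
    have hne' : contourPos n β ω (β f) ≠ k := fun h' => hne (by rw [← h6.2, h'])
    have h5 := h.noncrossing (p := contourPos n β ω (β k)) (z := contourPos n β ω (β f)) (k := k)
      (z' := f) (by omega) (by omega) hk hf hp.2 (Or.inr ⟨h6.2, by rwa [h6.2]⟩)
    have h4 := h.pos_white_spec hf
    have h7 := h.noncrossing (z' := contourPos n β ω (ω f) - 1) h5.1 h5.2 hk h4.1 hp.2
      (Or.inl h4.2.symm)
    omega
  · have h7 := h.noncrossing (p := contourPos n β ω (β k)) (z := m - 1) (by omega) (by omega) hk
      hm3.1 hp.2 (Or.inl hm3.2.symm)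
    omega

theorem black_eq_of_pos_eq {β' ω' : ℕ → S} {W' : ℕ → ℝ} (h : ContourCode n β ω)
    (h' : ContourCode n β' ω') (hW : IsFlow n β ω W wt) (hW' : IsFlow n β' ω' W' wt)
    (hpos : contourPos n β ω = contourPos n β' ω') {k : ℕ} (hk : k < n) : β k = β' k := by
  apply h.pos_injective
  have a1 := pos_black_le (β := β) (ω := ω) hk
  have a2 := pos_black_le (β := β') (ω := ω') hk
  have b1 := h.partialSum_pos_black_lt hW hk
  have b2 := h'.partialSum_pos_black_lt hW' hk
  rw [← hpos] at a2 b2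
  rcases lt_trichotomy (contourPos n β ω (β k)) (contourPos n β ω (β' k)) with hlt | heq | hlt
  · have := h.partialSum_lt_of_pos_black_lt hW hk hlt a2
    linarith
  · exact heq
  · have := h'.partialSum_lt_of_pos_black_lt hW' hk (hpos ▸ hlt) a1
    rw [← hpos] at this
    linarith

theorem white_eq_of_pos_eq {β' ω' : ℕ → S} {W' : ℕ → ℝ} (h : ContourCode n β ω)
    (h' : ContourCode n β' ω') (hW : IsFlow n β ω W wt) (hW' : IsFlow n β' ω' W' wt)
    (hpos : contourPos n β ω = contourPos n β' ω') {k : ℕ} (hk : k < n) : ω k = ω' k := by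
  have := black_eq_of_pos_eq h.dual h'.dual hW.dual hW'.dual
    (by rw [h.pos_dual, h'.pos_dual, hpos]) (show n - 1 - k < n by omega)
  rwa [show n - 1 - (n - 1 - k) = k by omega] at this

end ContourCode

end

/-! ### The contour of a plane bipartite tree as a permutation of its edges. -/

noncomputable section

namespace WBPTree

variable (T : WBPTree)

/-- The edges of a tree, as pairs (black end, white end). -/
def BEdge : Type := {p : T.V × T.V // p.1 ∈ T.black ∧ T.graph.Adj p.1 p.2}

variable {T}

namespace BEdge

instance : Finite T.BEdge := inferInstanceAs (Finite (Subtype _))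

/-- The black end. -/
def b (e : T.BEdge) : T.V := e.1.1

/-- The white end. -/
def w (e : T.BEdge) : T.V := e.1.2

theorem b_mem (e : T.BEdge) : e.b ∈ T.black := e.2.1

theorem adj (e : T.BEdge) : T.graph.Adj e.b e.w := e.2.2

theorem w_notMem (e : T.BEdge) : e.w ∉ T.black := (T.bicolored _ _ e.adj).1 e.b_mem

theorem b_ne_w (e f : T.BEdge) : e.b ≠ f.w := fun h => f.w_notMem (h ▸ e.b_mem)

theorem ext {e f : T.BEdge} (hb : e.b = f.b) (hw : e.w = f.w) : e = f :=
  Subtype.ext (Prod.ext hb hw)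

/-- The edge as an element of the edge set. -/
def toEdge (e : T.BEdge) : T.graph.edgeSet := ⟨s(e.b, e.w), e.adj⟩

theorem toEdge_bijective : Function.Bijective (toEdge : T.BEdge → T.graph.edgeSet) := by
  constructor
  · intro e f h
    have : s(e.b, e.w) = s(f.b, f.w) := congrArg Subtype.val h
    rcases Sym2.eq_iff.1 this with ⟨h1, h2⟩ | ⟨h1, -⟩
    · exact ext h1 h2
    · exact absurd h1 (e.b_ne_w f)
  · rintro ⟨e, he⟩
    induction e using Sym2.ind with
    | _ u v =>
      by_cases hu : u ∈ T.black
      · exact ⟨⟨(u, v), hu, he⟩, rfl⟩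
      · refine ⟨⟨(v, u), ?_, T.graph.adj_symm he⟩, Subtype.ext Sym2.eq_swap⟩
        exact (T.bicolored v u (T.graph.adj_symm he)).2 hu

theorem card_add_one : Nat.card T.BEdge + 1 = Nat.card T.V := by
  classical
  rw [Nat.card_congr (Equiv.ofBijective _ toEdge_bijective), Nat.card_eq_fintype_card,
    Nat.card_eq_fintype_card, ← T.isTree.card_edgeFinset, SimpleGraph.edgeFinset_card]

end BEdge

/-- The edge at a black vertex `v` towards `u`. -/
def blackEdge {v : T.V} (hv : v ∈ T.black) (u : T.graph.neighborSet v) : T.BEdge :=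
  ⟨(v, u), hv, u.2⟩

/-- The edge at a white vertex `v` towards `u`. -/
def whiteEdge {v : T.V} (hv : v ∉ T.black) (u : T.graph.neighborSet v) : T.BEdge :=
  ⟨(u, v), (T.bicolored _ _ (T.graph.adj_symm u.2)).2 hv, T.graph.adj_symm u.2⟩

variable (T)

/-- Rotation of the edges around their black ends. -/
def rotB : Equiv.Perm T.BEdge where
  toFun e := blackEdge e.b_mem (T.rot e.b ⟨e.w, e.adj⟩)
  invFun e := blackEdge e.b_mem ((T.rot e.b).symm ⟨e.w, e.adj⟩)
  left_inv e := BEdge.ext rfl (congrArg Subtype.val ((T.rot e.b).symm_apply_apply ⟨e.w, e.adj⟩))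
  right_inv e := BEdge.ext rfl (congrArg Subtype.val ((T.rot e.b).apply_symm_apply ⟨e.w, e.adj⟩))

/-- Rotation of the edges around their white ends. -/
def rotW : Equiv.Perm T.BEdge where
  toFun e := whiteEdge e.w_notMem (T.rot e.w ⟨e.b, T.graph.adj_symm e.adj⟩)
  invFun e := whiteEdge e.w_notMem ((T.rot e.w).symm ⟨e.b, T.graph.adj_symm e.adj⟩)
  left_inv e := BEdge.ext
    (congrArg Subtype.val ((T.rot e.w).symm_apply_apply ⟨e.b, T.graph.adj_symm e.adj⟩)) rfl
  right_inv e := BEdge.ext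
    (congrArg Subtype.val ((T.rot e.w).apply_symm_apply ⟨e.b, T.graph.adj_symm e.adj⟩)) rfl

/-- One step along the contour of the tree. -/
def contour : Equiv.Perm T.BEdge := T.rotB * T.rotW

variable {T}

theorem rotW_w (e : T.BEdge) : (T.rotW e).w = e.w := rfl

theorem exists_rotB_pow {e f : T.BEdge} (h : e.b = f.b) : ∃ k : ℕ, (T.rotB ^ k) e = f := by
  obtain ⟨k, hk⟩ := ((T.rot_isCycle e.b).2 (Set.mem_univ ⟨e.w, e.adj⟩)
    (Set.mem_univ ⟨f.w, h ▸ f.adj⟩)).exists_nat_pow_eq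
  refine ⟨k, ?_⟩
  have : ∀ k : ℕ, (T.rotB ^ k) e = blackEdge e.b_mem ((T.rot e.b ^ k) ⟨e.w, e.adj⟩) := by
    intro k
    induction k with
    | zero => rfl
    | succ k ih => rw [pow_succ', pow_succ', Equiv.Perm.mul_apply, ih]; rfl
  rw [this, hk]
  exact BEdge.ext h rfl

theorem exists_rotW_pow {e f : T.BEdge} (h : e.w = f.w) : ∃ k : ℕ, (T.rotW ^ k) e = f := by
  obtain ⟨k, hk⟩ := ((T.rot_isCycle e.w).2 (Set.mem_univ ⟨e.b, T.graph.adj_symm e.adj⟩)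
    (Set.mem_univ ⟨f.b, h ▸ T.graph.adj_symm f.adj⟩)).exists_nat_pow_eq
  refine ⟨k, ?_⟩
  have : ∀ k : ℕ, (T.rotW ^ k) e =
      whiteEdge e.w_notMem ((T.rot e.w ^ k) ⟨e.b, T.graph.adj_symm e.adj⟩) := by
    intro k
    induction k with
    | zero => rfl
    | succ k ih => rw [pow_succ', pow_succ', Equiv.Perm.mul_apply, ih]; rfl
  rw [this, hk]
  exact BEdge.ext rfl h

/-- Every edge of a tree is a bridge: `D` consists of the edges whose white end stays connected to
that of `x` once `x` is removed. -/
theorem exists_cut (x : T.BEdge) : ∃ D : Set T.BEdge, x ∈ D ∧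
    (∀ e f : T.BEdge, e ∈ D → e.w = f.w → f ∈ D) ∧
    (∀ e f : T.BEdge, e ∈ D → e ≠ x → e.b = f.b → f ∈ D ∧ f ≠ x) := by
  have hbr := SimpleGraph.isBridge_iff.1
    (SimpleGraph.isAcyclic_iff_forall_adj_isBridge.1 T.isTree.isAcyclic x.adj)
  set G' := T.graph \ SimpleGraph.fromEdgeSet {s(x.b, x.w)} with hG'
  have adj' : ∀ e : T.BEdge, e ≠ x → G'.Adj e.b e.w := by
    intro e he
    rw [hG', SimpleGraph.sdiff_adj]
    refine ⟨e.adj, fun h => he (BEdge.toEdge_bijective.1 (Subtype.ext ?_))⟩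
    exact (SimpleGraph.fromEdgeSet_adj _ |>.1 h).1
  refine ⟨{e | G'.Reachable x.w e.w}, SimpleGraph.Reachable.refl _, ?_, ?_⟩
  · intro e f he hef
    simpa only [Set.mem_ofPred_eq, ← hef] using he
  · intro e f he hex hef
    have h1 : G'.Reachable x.w f.b := hef ▸ SimpleGraph.Reachable.trans he (adj' e hex).symm.reachable
    have hfx : f ≠ x := by
      rintro rfl
      exact hbr h1.symm
    exact ⟨h1.trans (adj' f hfx).reachable, hfx⟩

theorem exists_end_of_saturated (A : Set T.BEdge) (hA : A.Nonempty)
    (hsat : ∀ e f : T.BEdge, e ∈ A → (e.b = f.b ∨ e.w = f.w) → f ∈ A) (v : T.V) :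
    ∃ f ∈ A, f.b = v ∨ f.w = v := by
  obtain ⟨a, ha⟩ := hA
  have step : ∀ u v : T.V, T.graph.Adj u v → (∃ f ∈ A, f.b = u ∨ f.w = u) →
      ∃ f ∈ A, f.b = v ∨ f.w = v := by
    rintro u v huv ⟨f, hf, hfu⟩
    by_cases hu : u ∈ T.black
    · refine ⟨⟨(u, v), hu, huv⟩, hsat f _ hf (Or.inl ?_), Or.inr rfl⟩
      rcases hfu with hfu | hfu
      · exact hfu
      · exact absurd (hfu ▸ hu) f.w_notMem
    · refine ⟨⟨(v, u), (T.bicolored _ _ huv.symm).2 hu, huv.symm⟩, hsat f _ hf (Or.inr ?_),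
        Or.inl rfl⟩
      rcases hfu with hfu | hfu
      · exact absurd (hfu ▸ f.b_mem) hu
      · exact hfu
  have all : ∀ u v : T.V, T.graph.Walk u v → (∃ f ∈ A, f.b = u ∨ f.w = u) →
      ∃ f ∈ A, f.b = v ∨ f.w = v := by
    intro u v p
    induction p with
    | nil => exact id
    | cons h _ ih => exact fun h' => ih (step _ _ h h')
  obtain ⟨p⟩ := T.isTree.connected.preconnected a.b v
  exact all _ _ p ⟨a, ha, Or.inl rfl⟩

theorem mem_of_saturated (A : Set T.BEdge) (hA : A.Nonempty)
    (hsat : ∀ e f : T.BEdge, e ∈ A → (e.b = f.b ∨ e.w = f.w) → f ∈ A) (e : T.BEdge) : e ∈ A := by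
  obtain ⟨f, hf, hfe | hfe⟩ := exists_end_of_saturated A hA hsat e.b
  · exact hsat f e hf (Or.inl hfe)
  · exact absurd hfe.symm (e.b_ne_w f)

/-- Otherwise the forward orbit of `x` never rotates onto `x` around its white end, so it stays on
the white side of the cut and never returns to `x`, although the contour has finite order. -/
theorem sameCycle_contour_rotW_symm (x : T.BEdge) : T.contour.SameCycle x (T.rotW.symm x) := by
  by_contra hcon
  obtain ⟨D, hxD, hw, hb⟩ := exists_cut x
  have key : ∀ k : ℕ, (T.contour ^ k) x ∈ D ∧ (0 < k → (T.contour ^ k) x ≠ x) := by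
    intro k
    induction k with
    | zero => exact ⟨hxD, fun h => absurd h (lt_irrefl _)⟩
    | succ k ih =>
      have h1 : T.rotW ((T.contour ^ k) x) ≠ x := by
        intro h
        refine hcon ⟨k, ?_⟩
        rw [zpow_natCast, ← h, Equiv.symm_apply_apply, h]
      rw [pow_succ', Equiv.Perm.mul_apply]
      have := hb _ (T.contour ((T.contour ^ k) x)) (hw _ (T.rotW ((T.contour ^ k) x)) ih.1 rfl) h1 rfl
      exact ⟨this.1, fun _ => this.2⟩
  have : 0 < orderOf T.contour := orderOf_pos _
  exact (key _).2 this (by rw [pow_orderOf_eq_one]; rfl)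

/-- Both rotations preserve the contour cycles, because `rotB` is the contour applied after the
inverse of `rotW`. Connectivity of the tree then leaves a single cycle. -/
theorem sameCycle_contour (e f : T.BEdge) : T.contour.SameCycle e f := by
  have hw : ∀ x, T.contour.SameCycle x (T.rotW x) := fun x => by
    simpa using (sameCycle_contour_rotW_symm (T.rotW x)).symm
  have hb : ∀ x, T.contour.SameCycle x (T.rotB x) := fun x => by
    have : T.rotB x = T.contour (T.rotW.symm x) := by simp [contour]
    rw [this]
    exact (sameCycle_contour_rotW_symm x).trans ⟨1, rfl⟩
  have hpow : ∀ (g : Equiv.Perm T.BEdge), (∀ x, T.contour.SameCycle x (g x)) →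
      ∀ (k : ℕ) x, T.contour.SameCycle x ((g ^ k) x) := by
    intro g hg k x
    induction k with
    | zero => exact Equiv.Perm.SameCycle.refl _ _
    | succ k ih => rw [pow_succ', Equiv.Perm.mul_apply]; exact ih.trans (hg _)
  refine mem_of_saturated {f | T.contour.SameCycle e f} ⟨e, Equiv.Perm.SameCycle.refl _ _⟩ ?_ f
  rintro x y hx (hxy | hxy)
  · obtain ⟨k, rfl⟩ := exists_rotB_pow hxy
    exact Equiv.Perm.SameCycle.trans hx (hpow _ hb k x)
  · obtain ⟨k, rfl⟩ := exists_rotW_pow hxy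
    exact Equiv.Perm.SameCycle.trans hx (hpow _ hw k x)

/-- The contour, starting at the edge `e`. -/
def walk (e : T.BEdge) (k : ℕ) : T.BEdge := (T.contour ^ k) e

theorem walk_succ (e : T.BEdge) (k : ℕ) : walk e (k + 1) = T.contour (walk e k) := by
  rw [walk, pow_succ', Equiv.Perm.mul_apply, walk]

theorem isCycleOn_contour (s : Finset T.BEdge) (hs : ∀ e, e ∈ s) :
    T.contour.IsCycleOn s := by
  refine ⟨⟨fun _ _ => hs _, T.contour.injective.injOn, fun x _ => ⟨T.contour.symm x, hs _, ?_⟩⟩,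
    fun x _ y _ => sameCycle_contour x y⟩
  simp

theorem walk_surjective (e f : T.BEdge) : ∃ k < Nat.card T.BEdge, walk e k = f := by
  have := Fintype.ofFinite T.BEdge
  rw [Nat.card_eq_fintype_card]
  exact (isCycleOn_contour Finset.univ Finset.mem_univ).exists_pow_eq
    (Finset.mem_univ e) (Finset.mem_univ f)

theorem walk_injOn (e : T.BEdge) {k l : ℕ} (hk : k < Nat.card T.BEdge) (hl : l < Nat.card T.BEdge)
    (h : walk e k = walk e l) : k = l := by
  have := Fintype.ofFinite T.BEdge
  rw [Nat.card_eq_fintype_card] at hk hl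
  have := ((isCycleOn_contour Finset.univ Finset.mem_univ).pow_apply_eq_pow_apply
    (Finset.mem_univ e)).1 h
  exact Nat.ModEq.eq_of_lt_of_lt this hk hl

theorem walk_card (e : T.BEdge) : walk e (Nat.card T.BEdge) = e := by
  have := Fintype.ofFinite T.BEdge
  rw [Nat.card_eq_fintype_card]
  exact ((isCycleOn_contour Finset.univ Finset.mem_univ).pow_apply_eq (Finset.mem_univ e)).2
    dvd_rfl

end WBPTree

end

/-! ### Codes of labeled trees and reconstruction up to isomorphism. -/

noncomputable section

namespace Passport.LWBPTree

open WBPTree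

variable {S : Type*} [Fintype S] {Ξ : Passport S}

theorem lab_bijective (hfull : Ξ.IsFull) (T : LWBPTree Ξ) : Function.Bijective T.lab := by
  refine ⟨fun u v huv => ?_, T.lab_surjective⟩
  have h := T.card_fiber (T.lab v)
  rw [hfull, Nat.card_eq_one_iff_unique] at h
  have := h.1
  exact congrArg Subtype.val (Subsingleton.elim (⟨u, huv⟩ : {x : T.V // T.lab x = T.lab v}) ⟨v, rfl⟩)

theorem card_bEdge (hfull : Ξ.IsFull) (T : LWBPTree Ξ) :
    Nat.card T.BEdge = Fintype.card S - 1 := by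
  have h := BEdge.card_add_one (T := T.toWBPTree)
  rw [Nat.card_congr (Equiv.ofBijective _ (lab_bijective hfull T)),
    Nat.card_eq_fintype_card (α := S)] at h
  omega

/-- Labels of the black ends of the edges along the contour. -/
def blackCode (T : LWBPTree Ξ) (e : T.BEdge) (k : ℕ) : S := T.lab (walk e k).b

/-- Labels of the white ends of the edges along the contour. -/
def whiteCode (T : LWBPTree Ξ) (e : T.BEdge) (k : ℕ) : S := T.lab (walk e k).w

theorem exists_end {T : WBPTree} (e : T.BEdge) (v : T.V) : ∃ f : T.BEdge, f.b = v ∨ f.w = v := by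
  obtain ⟨f, -, hf⟩ := exists_end_of_saturated Set.univ ⟨e, trivial⟩ (fun _ _ _ _ => trivial) v
  exact ⟨f, hf⟩

/-- The linking edge between consecutive contour edges is the intermediate one, reached after `rotW`
and before `rotB`. The cuts come from bridges, and fullness makes labels as good as vertices. -/
theorem contourCode (hfull : Ξ.IsFull) (T : LWBPTree Ξ) (e : T.BEdge) :
    ContourCode (Fintype.card S - 1) (T.blackCode e) (T.whiteCode e) := by
  have hcard := card_bEdge hfull T
  have hinj := (lab_bijective hfull T).1
  have hsurj : ∀ f, ∃ k < Fintype.card S - 1, walk e k = f := hcard ▸ walk_surjective e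
  have hpos : 0 < Fintype.card S - 1 := by
    rw [← hcard]
    have : Nonempty T.BEdge := ⟨e⟩
    exact Nat.card_pos
  refine ⟨hpos, ?_, ?_, ?_, ?_, ?_, ?_⟩
  · intro m hm
    obtain ⟨f, hf, hfm⟩ := hsurj (T.rotW (walk e m))
    refine ⟨f, hf, ?_, ?_⟩
    · simp only [whiteCode, hfm, rotW_w]
    · simp only [blackCode, hfm, walk_succ]; rfl
  · obtain ⟨f, hf, hfm⟩ := hsurj (T.rotW (walk e (Fintype.card S - 1 - 1)))
    refine ⟨f, hf, ?_, ?_⟩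
    · simp only [whiteCode, hfm, rotW_w]
    · have h1 := walk_succ e (Fintype.card S - 1 - 1)
      rw [show Fintype.card S - 1 - 1 + 1 = Nat.card T.BEdge by omega, walk_card] at h1
      simp only [blackCode, hfm]
      conv_rhs => rw [show walk e 0 = e from rfl, h1]
      rfl
  · exact fun a _ b _ hab => BEdge.b_ne_w _ _ (hinj hab)
  · intro s
    obtain ⟨v, rfl⟩ := T.lab_surjective s
    obtain ⟨f, hf⟩ := exists_end e v
    obtain ⟨k, hk, rfl⟩ := hsurj f
    exact ⟨k, hk, hf.imp (congrArg _) (congrArg _)⟩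
  · rintro A ⟨a, ha, haA⟩ hsat k hk
    obtain ⟨l, hl, hlA, hlk⟩ := mem_of_saturated {f | ∃ k < Fintype.card S - 1, k ∈ A ∧ walk e k = f}
      ⟨_, a, ha, haA, rfl⟩ (by
        rintro x y ⟨k, hk, hkA, rfl⟩ hxy
        obtain ⟨l, hl, rfl⟩ := hsurj y
        exact ⟨l, hl, hsat k hk l hl hkA (hxy.imp (congrArg T.lab) (congrArg T.lab)), rfl⟩) (walk e k)
    rwa [← walk_injOn e (hcard ▸ hl) (hcard ▸ hk) hlk]
  · intro x hx
    obtain ⟨D, hxD, hw, hb⟩ := exists_cut (walk e x)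
    refine ⟨{k | walk e k ∈ D}, hxD, fun a ha b hb' haD hab => hw _ _ haD (hinj hab), ?_⟩
    intro a ha b hb' haD hax hab
    have := hb _ _ haD (fun h => hax (walk_injOn e (hcard ▸ ha) (hcard ▸ hx) h)) (hinj hab)
    exact ⟨this.1, by rintro rfl; exact this.2 rfl⟩

theorem sum_walk (hfull : Ξ.IsFull) (T : LWBPTree Ξ) (e : T.BEdge) (p : T.BEdge → Prop)
    [DecidablePred p] [DecidablePred fun k => p (walk e k)] [Fintype T.BEdge] (W : T.BEdge → ℝ) :
    ∑ k ∈ Finset.range (Fintype.card S - 1) with p (walk e k), W (walk e k) =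
      ∑ f with p f, W f := by
  have hcard := card_bEdge hfull T
  refine Finset.sum_bij (fun k _ => walk e k) ?_ ?_ ?_ (fun _ _ => rfl)
  · intro k hk
    simpa using (Finset.mem_filter.1 hk).2
  · intro k hk l hl h
    simp only [Finset.mem_filter, Finset.mem_range] at hk hl
    exact walk_injOn e (hcard ▸ hk.1) (hcard ▸ hl.1) h
  · intro f hf
    obtain ⟨k, hk, rfl⟩ := walk_surjective e f
    exact ⟨k, Finset.mem_filter.2 ⟨Finset.mem_range.2 (hcard ▸ hk), (Finset.mem_filter.1 hf).2⟩, rfl⟩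

theorem isFlow (hfull : Ξ.IsFull) (T : LWBPTree Ξ) (e : T.BEdge) :
    IsFlow (Fintype.card S - 1) (T.blackCode e) (T.whiteCode e)
      (fun k => T.weight (walk e k).toEdge) Ξ.wt := by
  classical
  have hinj := (lab_bijective hfull T).1
  have := Fintype.ofFinite T.BEdge
  refine ⟨fun k _ => T.weight_pos _, fun s => ?_⟩
  obtain ⟨v, rfl⟩ := T.lab_surjective s
  have hb := sum_walk hfull T e (fun f => T.lab f.b = T.lab v) (fun f => T.weight f.toEdge)
  have hw := sum_walk hfull T e (fun f => T.lab f.w = T.lab v) (fun f => T.weight f.toEdge)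
  have goal : Ξ.wt (T.lab v) = ∑ f : T.BEdge with T.lab f.b = T.lab v, T.weight f.toEdge -
      ∑ f : T.BEdge with T.lab f.w = T.lab v, T.weight f.toEdge := by
    rw [T.wt_lab, vertexWeight]
    by_cases hv : v ∈ T.black
    · rw [if_pos hv, one_mul, Finset.filter_false_of_mem (p := fun f : T.BEdge => T.lab f.w = T.lab v),
        Finset.sum_empty, sub_zero]
      · refine Finset.sum_bij (fun u _ => blackEdge hv u) ?_ ?_ ?_ ?_
        · exact fun u _ => Finset.mem_filter.2 ⟨Finset.mem_univ _, rfl⟩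
        · intro u _ u' _ h
          exact Subtype.ext (congrArg BEdge.w h)
        · intro f hf
          have hf' : f.b = v := hinj (by simpa using hf)
          subst hf'
          exact ⟨⟨f.w, f.adj⟩, Finset.mem_univ _, rfl⟩
        · intro u _; rfl
      · intro f _ hf
        exact f.w_notMem (hinj hf ▸ hv)
    · rw [if_neg hv, Finset.filter_false_of_mem (p := fun f : T.BEdge => T.lab f.b = T.lab v),
        Finset.sum_empty, zero_sub, neg_one_mul, neg_inj]
      · refine Finset.sum_bij (fun u _ => whiteEdge hv u) ?_ ?_ ?_ ?_
        · exact fun u _ => Finset.mem_filter.2 ⟨Finset.mem_univ _, rfl⟩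
        · intro u _ u' _ h
          exact Subtype.ext (congrArg BEdge.b h)
        · intro f hf
          have hf' : f.w = v := hinj (by simpa using hf)
          subst hf'
          exact ⟨⟨f.b, T.graph.adj_symm f.adj⟩, Finset.mem_univ _, rfl⟩
        · intro u _
          exact congrArg T.weight (Subtype.ext Sym2.eq_swap)
      · intro f _ hf
        exact hv (hinj hf ▸ f.b_mem)
  rw [goal, ← hb, ← hw]
  simp only [blackCode, whiteCode]
  congr!

section Iso

variable {T T' : LWBPTree Ξ}

theorem exists_walk_of_code_eq (hfull : Ξ.IsFull) {e : T.BEdge} {e' : T'.BEdge}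
    (hb : ∀ k < Fintype.card S - 1, T.blackCode e k = T'.blackCode e' k)
    (hw : ∀ k < Fintype.card S - 1, T.whiteCode e k = T'.whiteCode e' k) (f : T.BEdge) :
    ∃ k < Fintype.card S - 1, walk e k = f ∧ T'.lab (walk e' k).b = T.lab f.b ∧
      T'.lab (walk e' k).w = T.lab f.w := by
  obtain ⟨k, hk, rfl⟩ := walk_surjective e f
  rw [card_bEdge hfull T] at hk
  exact ⟨k, hk, rfl, (hb k hk).symm, (hw k hk).symm⟩

theorem adj_of_code_eq (hfull : Ξ.IsFull) {e : T.BEdge} {e' : T'.BEdge}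
    (hb : ∀ k < Fintype.card S - 1, T.blackCode e k = T'.blackCode e' k)
    (hw : ∀ k < Fintype.card S - 1, T.whiteCode e k = T'.whiteCode e' k)
    {u v : T.V} {u' v' : T'.V} (hu : T'.lab u' = T.lab u) (hv : T'.lab v' = T.lab v)
    (h : T.graph.Adj u v) : T'.graph.Adj u' v' := by
  have hinj := (lab_bijective hfull T').1
  by_cases hub : u ∈ T.black
  · obtain ⟨k, -, -, h1, h2⟩ := exists_walk_of_code_eq hfull hb hw (⟨(u, v), hub, h⟩ : T.BEdge)
    rw [← hinj (h1.trans hu.symm), ← hinj (h2.trans hv.symm)]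
    exact (walk e' k).adj
  · obtain ⟨k, -, -, h1, h2⟩ := exists_walk_of_code_eq hfull hb hw
      (⟨(v, u), (T.bicolored _ _ h.symm).2 hub, h.symm⟩ : T.BEdge)
    rw [← hinj (h2.trans hu.symm), ← hinj (h1.trans hv.symm)]
    exact (walk e' k).adj.symm

theorem black_of_code_eq (hfull : Ξ.IsFull) {e : T.BEdge} {e' : T'.BEdge}
    (hb : ∀ k < Fintype.card S - 1, T.blackCode e k = T'.blackCode e' k)
    (hw : ∀ k < Fintype.card S - 1, T.whiteCode e k = T'.whiteCode e' k)
    {u : T.V} {u' : T'.V} (hu : T'.lab u' = T.lab u) (h : u ∈ T.black) : u' ∈ T'.black := by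
  have hinj := (lab_bijective hfull T').1
  obtain ⟨f, rfl | rfl⟩ := exists_end e u
  · obtain ⟨k, -, -, h1, -⟩ := exists_walk_of_code_eq hfull hb hw f
    rw [← hinj (h1.trans hu.symm)]
    exact (walk e' k).b_mem
  · exact absurd h f.w_notMem

/-- Matching labels gives the vertex bijection, and the induced edge map commutes with the contour.
The black end after one contour step is already the black end after `rotW`, so both rotations can be
read off from the code. -/
theorem isomorphic_of_code_eq (hfull : Ξ.IsFull) {e : T.BEdge} {e' : T'.BEdge}
    (hb : ∀ k < Fintype.card S - 1, T.blackCode e k = T'.blackCode e' k)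
    (hw : ∀ k < Fintype.card S - 1, T.whiteCode e k = T'.whiteCode e' k) :
    LWBPTree.Isomorphic T T' := by
  have hinj := (lab_bijective hfull T').1
  have hinj₀ := (lab_bijective hfull T).1
  have hb' := fun k hk => (hb k hk).symm
  have hw' := fun k hk => (hw k hk).symm
  let φ₀ : T.V ≃ T'.V := (Equiv.ofBijective _ (lab_bijective hfull T)).trans
    (Equiv.ofBijective _ (lab_bijective hfull T')).symm
  have hφ₀ : ∀ v, T'.lab (φ₀ v) = T.lab v := fun v =>
    Equiv.ofBijective_apply_symm_apply _ (lab_bijective hfull T') _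
  let φ : T.graph ≃g T'.graph := ⟨φ₀, fun {u v} =>
    ⟨adj_of_code_eq hfull hb' hw' (hφ₀ u).symm (hφ₀ v).symm,
      adj_of_code_eq hfull hb hw (hφ₀ u) (hφ₀ v)⟩⟩
  have hφ : ∀ v, T'.lab (φ v) = T.lab v := hφ₀
  have hblack : ∀ v, φ v ∈ T'.black ↔ v ∈ T.black := fun v =>
    ⟨black_of_code_eq hfull hb' hw' (hφ v).symm, black_of_code_eq hfull hb hw (hφ v)⟩
  let ψ : T.BEdge → T'.BEdge := fun f =>
    ⟨(φ f.b, φ f.w), (hblack _).2 f.b_mem, φ.map_adj_iff.2 f.adj⟩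
  have hψ : ∀ k < Fintype.card S - 1, ψ (walk e k) = walk e' k := fun k hk =>
    BEdge.ext (hinj ((hφ _).trans (hb k hk))) (hinj ((hφ _).trans (hw k hk)))
  -- The last index needs the closing of the contour: its successor is the starting edge.
  have hψsucc : ∀ k < Fintype.card S - 1, ψ (walk e (k + 1)) = walk e' (k + 1) := by
    intro k hk
    by_cases hk' : k + 1 < Fintype.card S - 1
    · exact hψ _ hk'
    · have hk1 : k + 1 = Fintype.card S - 1 := by omega
      rw [hk1]
      conv_lhs => rw [← card_bEdge hfull T, walk_card]
      conv_rhs => rw [← card_bEdge hfull T', walk_card]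
      exact hψ 0 (by omega)
  have hrotW : ∀ f, ψ (T.rotW f) = T'.rotW (ψ f) := by
    intro f
    obtain ⟨k, hk, rfl⟩ := walk_surjective e f
    rw [card_bEdge hfull T] at hk
    rw [hψ k hk]
    refine BEdge.ext ?_ ?_
    · have h1 := congrArg BEdge.b (hψsucc k hk)
      rw [walk_succ, walk_succ] at h1
      exact h1
    · exact (congrArg BEdge.w (hψ k hk) :)
  have hrotB : ∀ f, ψ (T.rotB f) = T'.rotB (ψ f) := by
    intro f
    obtain ⟨g, rfl⟩ := T.rotW.surjective f
    obtain ⟨k, hk, rfl⟩ := walk_surjective e g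
    rw [card_bEdge hfull T] at hk
    rw [hrotW, hψ k hk]
    have h1 := hψsucc k hk
    rw [walk_succ, walk_succ] at h1
    exact h1
  refine ⟨φ, ?_, hblack, ?_, hφ⟩
  · intro v u
    by_cases hv : v ∈ T.black
    · exact Subtype.ext (congrArg BEdge.w (hrotB (blackEdge hv u)))
    · exact Subtype.ext (congrArg BEdge.b (hrotW (whiteEdge hv u)))
  · intro x
    obtain ⟨f, rfl⟩ := BEdge.toEdge_bijective.2 x
    obtain ⟨k, hk, rfl⟩ := walk_surjective e f
    rw [card_bEdge hfull T] at hk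
    have h2 : φ.mapEdgeSet (walk e k).toEdge = (walk e' k).toEdge := by
      rw [← hψ k hk]; rfl
    rw [h2]
    have hF := isFlow hfull T e
    have hF' := isFlow hfull T' e'
    -- Both weight functions are flows for the same code and vertex weights, hence equal.
    have hF'' := hF'.congr hb hw
    exact (contourCode hfull T e).flow_unique hF'' hF hk

theorem exists_code_eq_of_isomorphic (h : LWBPTree.Isomorphic T T') (e : T.BEdge) :
    ∃ e' : T'.BEdge, T'.blackCode e' = T.blackCode e ∧ T'.whiteCode e' = T.whiteCode e := by
  obtain ⟨φ, hr, hb, -, hl⟩ := h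
  let ψ : T.BEdge → T'.BEdge := fun f =>
    ⟨(φ f.b, φ f.w), (hb _).2 f.b_mem, φ.map_adj_iff.2 f.adj⟩
  have hW : ∀ f, ψ (T.rotW f) = T'.rotW (ψ f) := fun f =>
    BEdge.ext (congrArg Subtype.val (hr f.w ⟨f.b, T.graph.adj_symm f.adj⟩)) rfl
  have hB : ∀ f, ψ (T.rotB f) = T'.rotB (ψ f) := fun f =>
    BEdge.ext rfl (congrArg Subtype.val (hr f.b ⟨f.w, f.adj⟩))
  have hwalk : ∀ k, walk (ψ e) k = ψ (walk e k) := by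
    intro k
    induction k with
    | zero => rfl
    | succ k ih =>
      rw [walk_succ, walk_succ, ih, contour, contour, Equiv.Perm.mul_apply, Equiv.Perm.mul_apply,
        hB, hW]
  refine ⟨ψ e, funext fun k => ?_, funext fun k => ?_⟩
  · rw [blackCode, hwalk]; exact hl _
  · rw [whiteCode, hwalk]; exact hl _

end Iso

end Passport.LWBPTree

end

/-! ### Cyclic orders, excursions and the tree of horizontal strips. -/

noncomputable section

section CyclicSucc

variable (α : Type*) [LinearOrder α] [Fintype α]

/-- The cyclic successor on a finite linear order. -/
def cyclicSucc : Equiv.Perm α :=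
  (Fintype.orderIsoFinOfCardEq α rfl).toEquiv.permCongr (finRotate (Fintype.card α))

theorem cyclicSucc_isCycleOn : (cyclicSucc α).IsCycleOn Set.univ := by
  refine ⟨Set.bijOn_univ.2 (cyclicSucc α).bijective, fun x _ y _ => ?_⟩
  have key : ∀ (m : ℕ) (i j : Fin m), (finRotate m).SameCycle i j := by
    intro m i j
    obtain _ | k := m
    · exact i.elim0
    have h : ∀ (t : ℕ) (ht : t < k + 1), ((finRotate (k + 1)) ^ t) 0 = ⟨t, ht⟩ := by
      intro t
      induction t with
      | zero => intro _; rfl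
      | succ t ih =>
        intro ht
        rw [pow_succ', Equiv.Perm.mul_apply, ih (by omega), finRotate_of_lt (by omega)]
    have h' : ∀ i : Fin (k + 1), (finRotate (k + 1)).SameCycle 0 i := fun i =>
      ⟨i.val, by rw [zpow_natCast, h _ i.isLt]⟩
    exact (h' i).symm.trans (h' j)
  set e := Fintype.orderIsoFinOfCardEq α rfl
  obtain ⟨t, ht⟩ := key _ (e.symm x) (e.symm y)
  refine ⟨t, ?_⟩
  have : ∀ s : ℤ, cyclicSucc α ^ s = e.toEquiv.permCongrHom (finRotate (Fintype.card α) ^ s) := by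
    intro s
    rw [map_zpow]
    rfl
  rw [this]
  change e ((finRotate (Fintype.card α) ^ t) (e.symm x)) = y
  rw [ht, e.apply_symm_apply]

variable {α}

theorem cyclicSucc_of_covBy {x y : α} (hxy : x < y) (h : ∀ z, x < z → y ≤ z) :
    cyclicSucc α x = y := by
  set e := Fintype.orderIsoFinOfCardEq α rfl with he
  change e (finRotate (Fintype.card α) (e.symm x)) = y
  have hlt : (e.symm x : Fin _) < e.symm y := e.symm.lt_iff_lt.2 hxy
  have hx : (e.symm x).val + 1 < Fintype.card α := by
    have := (e.symm y).isLt
    have : (e.symm x).val < (e.symm y).val := hlt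
    omega
  have hrot : finRotate (Fintype.card α) (e.symm x) = ⟨(e.symm x).val + 1, hx⟩ := by
    generalize e.symm x = i at hx
    revert i
    generalize Fintype.card α = m
    intro i hi
    obtain _ | k := m
    · exact i.elim0
    · exact finRotate_of_lt (by omega)
  rw [hrot]
  apply le_antisymm
  · rw [← e.apply_symm_apply y, e.le_iff_le]
    exact Nat.succ_le_of_lt hlt
  · apply h
    rw [← e.symm_apply_apply ⟨(e.symm x).val + 1, hx⟩] at *
    rw [← e.symm.lt_iff_lt]
    simp only [e.symm_apply_apply]
    exact Nat.lt_succ_self _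

theorem cyclicSucc_of_max {x y : α} (hx : ∀ z, z ≤ x) (hy : ∀ z, y ≤ z) :
    cyclicSucc α x = y := by
  set e := Fintype.orderIsoFinOfCardEq α rfl with he
  change e (finRotate (Fintype.card α) (e.symm x)) = y
  have hx' : ∀ i, i ≤ e.symm x := fun i => by
    rw [← e.symm_apply_apply i, e.symm.le_iff_le]; exact hx _
  have hrot : ∀ j, finRotate (Fintype.card α) (e.symm x) ≤ j := by
    generalize e.symm x = i at hx'
    revert i
    generalize Fintype.card α = m
    intro i hi j
    obtain _ | k := m
    · exact i.elim0
    · have : i = Fin.last k := le_antisymm (Fin.le_last i) (hi _)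
      rw [this, finRotate_last]
      exact Fin.zero_le j
  apply le_antisymm
  · rw [← e.apply_symm_apply y, e.le_iff_le]
    exact hrot _
  · exact hy _

end CyclicSucc

/-- `H` is positive and injective on `{1, …, n}` and vanishes at `0` and `n + 1`. -/
structure IsExcursion (n : ℕ) (H : ℕ → ℝ) : Prop where
  n_pos : 0 < n
  zero : H 0 = 0
  last : H (n + 1) = 0
  pos : ∀ k, 1 ≤ k → k ≤ n → 0 < H k
  inj : ∀ a b, 1 ≤ a → a ≤ n → 1 ≤ b → b ≤ n → H a = H b → a = b

/-- Steps `i < j` of the path `H` are joined by a horizontal strip below the path. -/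
def Arc (H : ℕ → ℝ) (i j : ℕ) : Prop :=
  i < j ∧ ∀ m, i < m → m ≤ j → H i < H m ∧ H (j + 1) < H m

/-- The arc from `i` to `j` is the strip just below the path at abscissa `k + 1`. -/
def ArcAt (H : ℕ → ℝ) (k i j : ℕ) : Prop :=
  Arc H i j ∧ i ≤ k ∧ k < j ∧ ∀ m, i < m → m ≤ j → H (k + 1) ≤ H m

namespace Arc

variable {H : ℕ → ℝ} {i j : ℕ}

theorem up (h : Arc H i j) : H i < H (i + 1) := (h.2 _ (by omega) h.1).1

theorem down (h : Arc H i j) : H (j + 1) < H j := (h.2 _ h.1 le_rfl).2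

end Arc

namespace IsExcursion

variable {n : ℕ} {H : ℕ → ℝ}

theorem nonneg (h : IsExcursion n H) {k : ℕ} (hk : k ≤ n + 1) : 0 ≤ H k := by
  rcases Nat.eq_zero_or_pos k with rfl | h1
  · rw [h.zero]
  · rcases Nat.lt_or_ge n k with h2 | h2
    · rw [show k = n + 1 by omega, h.last]
    · exact (h.pos k h1 h2).le

theorem exists_arcAt (h : IsExcursion n H) {k : ℕ} (hk : k < n) : ∃ i j, j ≤ n ∧ ArcAt H k i j := by
  classical
  have hpos := h.pos (k + 1) (by omega) (by omega)
  have hex : ∃ j, k < j ∧ H (j + 1) < H (k + 1) := ⟨n, hk, by rwa [h.last]⟩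
  have hi0 : (fun i => H i < H (k + 1)) 0 := by
    change H 0 < _
    rwa [h.zero]
  -- The strip just below height `H (k + 1)` extends left to the last step starting lower, and right
  -- to the first later step ending lower.
  have hi := Nat.findGreatest_spec (P := fun i => H i < H (k + 1)) (Nat.zero_le k) hi0
  have hik := Nat.findGreatest_le (P := fun i => H i < H (k + 1)) k
  have hig := fun m => Nat.findGreatest_is_greatest (P := fun i => H i < H (k + 1)) (n := k) (k := m)
  have hjs := Nat.find_spec hex
  have hjm := fun m => Nat.find_min (m := m) hex
  have hjn := Nat.find_min' hex ⟨hk, by rwa [h.last]⟩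
  set i := Nat.findGreatest (fun i => H i < H (k + 1)) k
  set j := Nat.find hex
  have hmin : ∀ m, i < m → m ≤ j → H (k + 1) ≤ H m := by
    intro m h1 h2
    by_cases hm : m ≤ k
    · exact not_lt.1 (hig m h1 hm)
    · by_cases hm' : m = k + 1
      · rw [hm']
      · have := hjm (m - 1) (by omega)
        rw [show m - 1 + 1 = m by omega] at this
        exact not_lt.1 fun h' => this ⟨by omega, h'⟩
  exact ⟨i, j, hjn, ⟨by omega, fun m h1 h2 =>
    ⟨lt_of_lt_of_le hi (hmin m h1 h2), lt_of_lt_of_le hjs.2 (hmin m h1 h2)⟩⟩, hik, hjs.1, hmin⟩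

/-- The top of a strip touches the path where `H` is minimal on `(i, j]`. -/
theorem exists_arcAt_of_arc {i j : ℕ} (h : Arc H i j) : ∃ k, ArcAt H k i j := by
  obtain ⟨m, hm, hmin⟩ := Finset.exists_min_image (Finset.Ioc i j) H ⟨j, by simpa using h.1⟩
  rw [Finset.mem_Ioc] at hm
  refine ⟨m - 1, h, by omega, by omega, fun l h1 h2 => ?_⟩
  rw [show m - 1 + 1 = m by omega]
  exact hmin l (Finset.mem_Ioc.2 ⟨h1, h2⟩)

theorem arcAt_unique {k i j i' j' : ℕ} (h : ArcAt H k i j) (h' : ArcAt H k i' j') :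
    i = i' ∧ j = j' := by
  obtain ⟨⟨-, h1⟩, h2, h3, h4⟩ := h
  obtain ⟨⟨-, h1'⟩, h2', h3', h4'⟩ := h'
  constructor
  · rcases lt_trichotomy i i' with hlt | heq | hlt
    · exact absurd (h4 i' hlt (by omega)) (not_le.2 (h1' (k + 1) (by omega) (by omega)).1)
    · exact heq
    · exact absurd (h4' i hlt (by omega)) (not_le.2 (h1 (k + 1) (by omega) (by omega)).1)
  · rcases lt_trichotomy j j' with hlt | heq | hlt
    · exact absurd (h4' (j + 1) (by omega) (by omega)) (not_le.2 (h1 (k + 1) (by omega) (by omega)).2)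
    · exact heq
    · exact absurd (h4 (j' + 1) (by omega) (by omega))
        (not_le.2 (h1' (k + 1) (by omega) (by omega)).2)

theorem left_eq_of_up {i i' j' : ℕ} (hi : H i < H (i + 1)) (h : ArcAt H i i' j') : i' = i := by
  by_contra hne
  have := h.2.1
  exact absurd (h.2.2.2 i (by omega) h.2.2.1.le) (not_le.2 hi)

theorem right_eq_of_down {j i' j' : ℕ} (hj : H (j + 1 + 1) < H (j + 1)) (h : ArcAt H j i' j') :
    j' = j + 1 := by
  by_contra hne
  have := h.2.2.1
  have := h.2.1
  exact absurd (h.2.2.2 (j + 1 + 1) (by omega) (by omega)) (not_le.2 hj)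

variable (n H)

/-- The graph of arcs. -/
def arcGraph : SimpleGraph (Fin (n + 1)) where
  Adj i j := Arc H i j ∨ Arc H j i
  symm := ⟨fun _ _ h => h.symm⟩
  loopless := ⟨fun i h => by rcases h with h | h <;> exact lt_irrefl _ h.1⟩

variable {n H}

/-- Induction on the rank of the height `H (k + 1)`: just below the bottom of a strip lies a lower
strip sharing an end with it. If the bottom is `H (j + 1)`, the strip at abscissa `j + 1` has the
same left end `i`; if it is `H i`, the strip at abscissa `i` has the same right end `j`. The descent
ends at step 0. -/
theorem arcGraph_connected (h : IsExcursion n H) : (arcGraph n H).Connected := by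
  have main : ∀ (r : ℕ) (k : ℕ) (_ : k < n),
      ((Finset.range n).filter fun l => H (l + 1) < H (k + 1)).card ≤ r →
      ∀ i j : Fin (n + 1), ArcAt H k i j → (arcGraph n H).Reachable 0 i := by
    intro r
    induction r using Nat.strong_induction_on with
    | _ r ih =>
    intro k hk hr i j hij
    by_cases hi0 : i = 0
    · rw [hi0]
    have hi1 : 0 < i.val := Nat.pos_of_ne_zero fun h' => hi0 (Fin.ext h')
    have hdec : ∀ k', k' < n → H (k' + 1) < H (k + 1) →
        ∀ i' j' : Fin (n + 1), ArcAt H k' i' j' → (arcGraph n H).Reachable 0 i' := by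
      intro k' hk' hlt
      refine ih _ (lt_of_lt_of_le (Finset.card_lt_card ?_) hr) k' hk' le_rfl
      rw [Finset.ssubset_iff_of_subset]
      · exact ⟨k', by simpa using ⟨hk', hlt⟩, by simp⟩
      · intro l
        simp only [Finset.mem_filter]
        exact fun hl => ⟨hl.1, hl.2.trans hlt⟩
    obtain ⟨⟨hlt, hA⟩, hik, hkj, hmin⟩ := hij
    obtain ⟨hHi, hHj⟩ := hA (k + 1) (by omega) (by omega)
    have hne : H i ≠ H (j + 1) := by
      intro heq
      have hp := h.pos i hi1 (by omega)
      by_cases hj : j.val = n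
      · rw [hj, h.last] at heq; linarith
      · have := h.inj i (j + 1) hi1 (by omega) (by omega) (by omega) heq
        omega
    rcases lt_or_gt_of_ne hne with hc | hc
    · have hjn : j.val + 1 ≤ n := by
        by_contra hj
        rw [show j.val = n by omega, h.last] at hc
        have := h.pos i hi1 (by omega)
        linarith
      obtain ⟨i', j', hj'n, hat⟩ := h.exists_arcAt (k := j) (by omega)
      have : i' = i.val := by
        obtain ⟨⟨h5, h6⟩, h7, h8, h9⟩ := hat
        by_contra hne'
        rcases Nat.lt_or_gt_of_ne hne' with h10 | h10
        · exact absurd (h9 i h10 (by omega)) (not_le.2 hc)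
        · exact absurd (hA i' h10 (by omega)).2 (not_lt.2 (h6 (j + 1) (by omega) (by omega)).1.le)
      subst this
      exact hdec j (by omega) hHj i ⟨j', by omega⟩ hat
    · obtain ⟨i', j', hj'n, hat⟩ := h.exists_arcAt (k := i - 1) (by omega)
      have hj' : j' = j.val := by
        obtain ⟨⟨h5, h6⟩, h7, h8, h9⟩ := hat
        rw [show i.val - 1 + 1 = i by omega] at h9
        have h11 := (h6 i (by omega) (by omega)).2
        by_contra hne'
        rcases Nat.lt_or_gt_of_ne hne' with h10 | h10
        · exact absurd (hA (j' + 1) (by omega) (by omega)).1 (not_lt.2 h11.le)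
        · exact absurd (h9 (j + 1) (by omega) (by omega)) (not_le.2 hc)
      subst hj'
      have hi'i : i' < n + 1 := by have := hat.2.1; omega
      have hr1 := hdec (i - 1) (by omega) (by rwa [show i.val - 1 + 1 = i by omega]) ⟨i', hi'i⟩ j hat
      have e1 : (arcGraph n H).Adj ⟨i', hi'i⟩ j := Or.inl hat.1
      have e2 : (arcGraph n H).Adj j i := Or.inr ⟨hlt, hA⟩
      exact (hr1.trans e1.reachable).trans e2.reachable
  have all : ∀ v : Fin (n + 1), (arcGraph n H).Reachable 0 v := by
    have hat : ∀ k, k < n → ∃ i j : Fin (n + 1), ArcAt H k i j ∧ (arcGraph n H).Reachable 0 i ∧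
        (arcGraph n H).Reachable 0 j := by
      intro k hk
      obtain ⟨i, j, hj, hA⟩ := h.exists_arcAt hk
      have hi : i < n + 1 := by have := hA.1.1; omega
      have h1 := main _ k hk le_rfl ⟨i, hi⟩ ⟨j, by omega⟩ hA
      have e1 : (arcGraph n H).Adj ⟨i, hi⟩ ⟨j, by omega⟩ := Or.inl hA.1
      exact ⟨⟨i, hi⟩, ⟨j, by omega⟩, hA, h1, h1.trans e1.reachable⟩
    intro v
    by_cases hup : v.val < n ∧ H v < H (v + 1)
    · obtain ⟨i, j, hA, h1, -⟩ := hat v hup.1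
      rwa [show v = i from Fin.ext (left_eq_of_up hup.2 hA).symm]
    · by_cases hv0 : v.val = 0
      · rw [show v = 0 from Fin.ext hv0]
      · obtain ⟨i, j, hA, -, h2⟩ := hat (v - 1) (by omega)
        have : H (v.val - 1 + 1 + 1) < H (v.val - 1 + 1) := by
          rw [show v.val - 1 + 1 = v by omega]
          by_cases hvn : v.val = n
          · rw [hvn, h.last]; exact h.pos n h.n_pos le_rfl
          · refine lt_of_le_of_ne (not_lt.1 fun h' => hup ⟨by omega, h'⟩) fun h' => ?_
            have := h.inj (v + 1) v (by omega) (by omega) (by omega) (by omega) h'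
            omega
        have := right_eq_of_down this hA
        rwa [show v = j from Fin.ext (by omega)]
  have : Nonempty (Fin (n + 1)) := ⟨0⟩
  exact ⟨fun u v => (all u).symm.trans (all v)⟩

/-- Each arc touches the path at one of `n` abscissas and no two arcs share one, so the connected
graph on `n + 1` vertices has at most `n` edges. -/
theorem arcGraph_isTree (h : IsExcursion n H) : (arcGraph n H).IsTree := by
  have hc := h.arcGraph_connected
  rw [SimpleGraph.isTree_iff_connected_and_card]
  refine ⟨hc, le_antisymm ?_ hc.card_vert_le_card_edgeSet_add_one⟩
  have hex : ∀ e : (arcGraph n H).edgeSet, ∃ k : Fin n, ∃ i j : Fin (n + 1), ArcAt H k i j ∧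
      e.1 = s(i, j) := by
    rintro ⟨e, he⟩
    induction e using Sym2.ind with
    | _ i j =>
      rcases he with he | he
      · obtain ⟨k, hk⟩ := exists_arcAt_of_arc he
        exact ⟨⟨k, by have := hk.2.2.1; omega⟩, i, j, hk, rfl⟩
      · obtain ⟨k, hk⟩ := exists_arcAt_of_arc he
        exact ⟨⟨k, by have := hk.2.2.1; omega⟩, j, i, hk, Sym2.eq_swap⟩
  choose f i j hat hij using hex
  have hf : Function.Injective f := by
    intro e e' hee
    have h1 := hat e
    have h2 := hat e'
    rw [hee] at h1
    obtain ⟨h3, h4⟩ := arcAt_unique h1 h2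
    apply Subtype.ext
    rw [hij, hij, Fin.ext h3, Fin.ext h4]
  have := Nat.card_le_card_of_injective f hf
  simpa using this

end IsExcursion

end

/-! ### Strip widths and the weighted plane tree of an excursion. -/

noncomputable section

/-- The minimum of `H` over `(i, j]`. -/
def pathMin (H : ℕ → ℝ) (i j : ℕ) : ℝ :=
  if h : i < j then (Finset.Ioc i j).inf' (Finset.nonempty_Ioc.2 h) H else 0

theorem pathMin_succ_self (H : ℕ → ℝ) (i : ℕ) : pathMin H i (i + 1) = H (i + 1) := by
  rw [pathMin, dif_pos (by omega)]
  apply le_antisymm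
  · exact Finset.inf'_le _ (by simp)
  · refine Finset.le_inf' _ _ fun m hm => ?_
    rw [Finset.mem_Ioc] at hm
    rw [show m = i + 1 by omega]

theorem pathMin_succ_right (H : ℕ → ℝ) {i j : ℕ} (hij : i < j) :
    pathMin H i (j + 1) = min (pathMin H i j) (H (j + 1)) := by
  rw [pathMin, pathMin, dif_pos (by omega), dif_pos hij]
  apply le_antisymm
  · refine le_min (Finset.le_inf' _ _ fun m hm => Finset.inf'_le _ ?_) (Finset.inf'_le _ ?_)
    · simp only [Finset.mem_Ioc] at hm ⊢; omega
    · simp only [Finset.mem_Ioc]; omega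
  · refine Finset.le_inf' _ _ fun m hm => ?_
    rw [Finset.mem_Ioc] at hm
    rcases Nat.lt_or_ge j m with h | h
    · rw [show m = j + 1 by omega]; exact min_le_right _ _
    · exact (min_le_left _ _).trans (Finset.inf'_le _ (by simp only [Finset.mem_Ioc]; omega))

theorem pathMin_left (H : ℕ → ℝ) {i j : ℕ} (hij : i + 1 < j) :
    pathMin H i j = min (H (i + 1)) (pathMin H (i + 1) j) := by
  rw [pathMin, pathMin, dif_pos (by omega), dif_pos hij]
  apply le_antisymm
  · refine le_min (Finset.inf'_le _ ?_) (Finset.le_inf' _ _ fun m hm => Finset.inf'_le _ ?_)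
    · simp only [Finset.mem_Ioc]; omega
    · simp only [Finset.mem_Ioc] at hm ⊢; omega
  · refine Finset.le_inf' _ _ fun m hm => ?_
    rw [Finset.mem_Ioc] at hm
    rcases Nat.lt_or_ge (i + 1) m with h | h
    · exact (min_le_right _ _).trans (Finset.inf'_le _ (by simp only [Finset.mem_Ioc]; omega))
    · rw [show m = i + 1 by omega]; exact min_le_left _ _

/-- The width of the strip joining steps `i` and `j`. -/
def arcWeight (H : ℕ → ℝ) (i j : ℕ) : ℝ := max 0 (pathMin H i j - max (H i) (H (j + 1)))

theorem arcWeight_pos_iff {H : ℕ → ℝ} {i j : ℕ} (hij : i < j) : 0 < arcWeight H i j ↔ Arc H i j := by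
  rw [arcWeight, lt_max_iff, pathMin, dif_pos hij, sub_pos, Finset.lt_inf'_iff]
  simp only [lt_irrefl, false_or, Finset.mem_Ioc, max_lt_iff, Arc, hij, true_and, and_imp]

theorem arcWeight_eq_zero {H : ℕ → ℝ} {i j : ℕ} (hij : i < j) (h : ¬ Arc H i j) :
    arcWeight H i j = 0 :=
  le_antisymm (not_lt.1 fun h' => h ((arcWeight_pos_iff hij).1 h')) (le_max_left _ _)

/-- The telescoping identity for strip widths: with `m` the running minimum and `y` the next height,
`min m y` is the next running minimum. -/
theorem max_zero_sub_max (m x y : ℝ) : max 0 (m - max x y) = max x m - max x (min m y) := by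
  rcases le_total x y with h1 | h1 <;> rcases le_total m x with h2 | h2 <;>
    rcases le_total m y with h3 | h3 <;>
    simp only [max_eq_left, max_eq_right, min_eq_left, min_eq_right, h1, h2, h3, sub_nonneg,
      sub_nonpos, sub_self] <;> linarith

namespace WBPTree

variable {T : WBPTree} {v : T.V}

open Classical in
theorem vertexWeight_of_mem (hv : v ∈ T.black) :
    T.vertexWeight v = ∑ u : T.graph.neighborSet v, T.weight ⟨s(v, (u : T.V)), u.2⟩ := by
  rw [vertexWeight, if_pos hv, one_mul]

open Classical in
theorem vertexWeight_of_notMem (hv : v ∉ T.black) :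
    T.vertexWeight v = -∑ u : T.graph.neighborSet v, T.weight ⟨s(v, (u : T.V)), u.2⟩ := by
  rw [vertexWeight, if_neg hv, neg_one_mul]

end WBPTree

namespace IsExcursion

variable {n : ℕ} {H : ℕ → ℝ}

/-- The strips leaving step `i` to the right stack up to fill its rise: the sum telescopes, and the
running minimum has dropped to at most `H i` by the end. -/
theorem sum_arcWeight_right (h : IsExcursion n H) {i : ℕ} (hi : i ≤ n) :
    ∑ j ∈ Finset.Ioc i n, arcWeight H i j = max (H i) (H (i + 1)) - H i := by
  have key : ∀ d, i + d ≤ n → ∑ j ∈ Finset.Ioc i (i + d), arcWeight H i j =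
      max (H i) (H (i + 1)) - max (H i) (pathMin H i (i + d + 1)) := by
    intro d
    induction d with
    | zero => intro _; simp [pathMin_succ_self]
    | succ d ih =>
      intro hd
      rw [← add_assoc, Finset.sum_Ioc_succ_top (by omega), ih (by omega), arcWeight,
        max_zero_sub_max, pathMin_succ_right H (show i < i + d + 1 by omega)]
      ring
  have h1 := key (n - i) (by omega)
  rw [show i + (n - i) = n by omega] at h1
  have h2 : pathMin H i (n + 1) ≤ H i := by
    rw [pathMin, dif_pos (by omega)]
    exact (Finset.inf'_le _ (by simp only [Finset.mem_Ioc]; omega : n + 1 ∈ _)).trans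
      (by rw [h.last]; exact h.nonneg (by omega))
  rw [h1, max_eq_left h2]

theorem sum_arcWeight_left (h : IsExcursion n H) {j : ℕ} (hj0 : 0 < j) (hj : j ≤ n) :
    ∑ i ∈ Finset.range j, arcWeight H i j = max (H (j + 1)) (H j) - H (j + 1) := by
  have key : ∀ d, d + 1 ≤ j → ∑ i ∈ Finset.range (d + 1), arcWeight H i j =
      max (H (j + 1)) (pathMin H d j) - H (j + 1) := by
    intro d
    induction d with
    | zero =>
      intro hd
      have h1 := h.nonneg (k := j + 1) (by omega)
      rw [zero_add, Finset.sum_range_one, arcWeight, h.zero, max_eq_right h1]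
      rcases le_total (H (j + 1)) (pathMin H 0 j) with h2 | h2
      · rw [max_eq_right (sub_nonneg.2 h2), max_eq_right h2]
      · rw [max_eq_left (sub_nonpos.2 h2), max_eq_left h2, sub_self]
    | succ d ih =>
      intro hd
      rw [Finset.sum_range_succ, ih (by omega), arcWeight, max_comm (H (d + 1)), max_zero_sub_max,
        pathMin_left H (show d + 1 < j by omega), min_comm (H (d + 1))]
      ring
  have h1 := key (j - 1) (by omega)
  have h2 : pathMin H (j - 1) j = H j := by
    have := pathMin_succ_self H (j - 1)
    rwa [show j - 1 + 1 = j by omega] at this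
  rw [show j - 1 + 1 = j by omega, h2] at h1
  exact h1

theorem mem_neighborSet_of_up {v u : Fin (n + 1)} (hv : H v < H (v + 1)) :
    u ∈ (arcGraph n H).neighborSet v ↔ Arc H v u := by
  rw [SimpleGraph.mem_neighborSet]
  refine ⟨fun h' => h'.resolve_right fun h'' => ?_, Or.inl⟩
  exact absurd h''.down (not_lt.2 hv.le)

theorem mem_neighborSet_of_not_up {v u : Fin (n + 1)} (hv : ¬ H v < H (v + 1)) :
    u ∈ (arcGraph n H).neighborSet v ↔ Arc H u v := by
  rw [SimpleGraph.mem_neighborSet]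
  exact ⟨fun h' => h'.resolve_left fun h'' => hv h''.up, Or.inr⟩

open Classical in
/-- The weighted plane tree of an excursion. -/
def tree (h : IsExcursion n H) : WBPTree where
  V := Fin (n + 1)
  graph := arcGraph n H
  isTree := h.arcGraph_isTree
  -- Around each vertex the neighbors are taken in increasing order of their step index, closed up
  -- cyclically.
  rot v := cyclicSucc _
  rot_isCycle v := cyclicSucc_isCycleOn _
  black := {v | H v < H (v + 1)}
  bicolored u v huv := by
    rcases huv with huv | huv
    · exact ⟨fun _ => not_lt.2 huv.down.le, fun _ => huv.up⟩
    · exact ⟨fun h' => absurd huv.down (not_lt.2 (le_of_lt h')), fun h' => absurd huv.up h'⟩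
  weight e := arcWeight H e.1.inf e.1.sup
  weight_pos := by
    rintro ⟨e, he⟩
    induction e using Sym2.ind with
    | _ i j =>
      rcases he with he | he
      · have hij : i ≤ j := he.1.le
        simp only [Sym2.inf_mk, Sym2.sup_mk, inf_eq_left.2 hij, sup_eq_right.2 hij]
        exact (arcWeight_pos_iff he.1).2 he
      · have hij : j ≤ i := he.1.le
        simp only [Sym2.inf_mk, Sym2.sup_mk, inf_eq_right.2 hij, sup_eq_left.2 hij]
        exact (arcWeight_pos_iff he.1).2 he

theorem tree_vertexWeight (h : IsExcursion n H) (v : Fin (n + 1)) :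
    h.tree.vertexWeight v = H (v + 1) - H v := by
  classical
  by_cases hv : H v < H (v + 1)
  · have hv' : v ∈ h.tree.black := hv
    refine (WBPTree.vertexWeight_of_mem hv').trans ?_
    have := h.sum_arcWeight_right (i := v) (by omega)
    rw [max_eq_right hv.le] at this
    rw [← this]
    -- Steps not joined to `v` have width zero, so only nonzero terms need matching.
    refine Finset.sum_bij_ne_zero (fun u _ _ => (show Fin (n + 1) from u.1).val) ?_ ?_ ?_ ?_
    · intro u _ _
      have hu := (mem_neighborSet_of_up hv).1 u.2
      rw [Finset.mem_Ioc]
      exact ⟨hu.1, by have := (show Fin (n + 1) from u.1).isLt; omega⟩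
    · intro u _ _ u' _ _ huu
      exact Subtype.ext (Fin.ext huu)
    · intro j hj hj0
      rw [Finset.mem_Ioc] at hj
      have hA : Arc H v j := by_contra fun hA => hj0 (arcWeight_eq_zero hj.1 hA)
      refine ⟨⟨(⟨j, by omega⟩ : Fin (n + 1)), (mem_neighborSet_of_up hv).2 hA⟩, Finset.mem_univ _,
        (h.tree.weight_pos _).ne', rfl⟩
    · intro u _ _
      have hu := (mem_neighborSet_of_up hv).1 u.2
      have hle : v ≤ (show Fin (n + 1) from u.1) := hu.1.le
      change arcWeight H (v ⊓ (show Fin (n + 1) from u.1) : Fin (n + 1))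
        (v ⊔ (show Fin (n + 1) from u.1) : Fin (n + 1)) = _
      rw [inf_eq_left.2 hle, sup_eq_right.2 hle]
  · have hv' : v ∉ h.tree.black := hv
    have hv0 : 0 < v.val := by
      by_contra h0
      apply hv
      rw [show v.val = 0 by omega, h.zero]
      exact h.pos _ le_rfl h.n_pos
    refine (WBPTree.vertexWeight_of_notMem hv').trans ?_
    have := h.sum_arcWeight_left hv0 (by omega)
    rw [max_eq_right (not_lt.1 hv)] at this
    have hsum : ∀ x : ℝ, x = H v - H (v + 1) → -x = H (v + 1) - H v := by
      intro x hx; rw [hx]; ring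
    apply hsum
    rw [← this]
    refine Finset.sum_bij_ne_zero (fun u _ _ => (show Fin (n + 1) from u.1).val) ?_ ?_ ?_ ?_
    · intro u _ _
      have hu := (mem_neighborSet_of_not_up hv).1 u.2
      rw [Finset.mem_range]
      exact hu.1
    · intro u _ _ u' _ _ huu
      exact Subtype.ext (Fin.ext huu)
    · intro j hj hj0
      rw [Finset.mem_range] at hj
      have hA : Arc H j v := by_contra fun hA => hj0 (arcWeight_eq_zero hj hA)
      refine ⟨⟨(⟨j, by omega⟩ : Fin (n + 1)), (mem_neighborSet_of_not_up hv).2 hA⟩,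
        Finset.mem_univ _, (h.tree.weight_pos _).ne', rfl⟩
    · intro u _ _
      have hu := (mem_neighborSet_of_not_up hv).1 u.2
      have hle : (show Fin (n + 1) from u.1) ≤ v := hu.1.le
      change arcWeight H (v ⊓ (show Fin (n + 1) from u.1) : Fin (n + 1))
        (v ⊔ (show Fin (n + 1) from u.1) : Fin (n + 1)) = _
      rw [inf_eq_right.2 hle, sup_eq_left.2 hle]

/-- An arc, as an edge of the tree. -/
def edge (h : IsExcursion n H) {i j : ℕ} (hj : j < n + 1) (hA : Arc H i j) : h.tree.BEdge :=
  ⟨((⟨i, hA.1.trans hj⟩ : Fin (n + 1)), (⟨j, hj⟩ : Fin (n + 1))), hA.up, Or.inl hA⟩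

theorem tree_rot (h : IsExcursion n H) (v : Fin (n + 1)) (u u' : (arcGraph n H).neighborSet v)
    (huu : (u < u' ∧ ∀ z, u < z → u' ≤ z) ∨ ((∀ z, z ≤ u) ∧ ∀ z, u' ≤ z)) :
    h.tree.rot v u = u' := by
  classical
  change cyclicSucc ((arcGraph n H).neighborSet v) u = u'
  rcases huu with ⟨h1, h2⟩ | ⟨h1, h2⟩
  · exact cyclicSucc_of_covBy h1 h2
  · exact cyclicSucc_of_max h1 h2

theorem rotW_edge (h : IsExcursion n H) {i i' j : ℕ} (hj : j < n + 1) (hA : Arc H i j)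
    (hA' : Arc H i' j)
    (hii : (i < i' ∧ ∀ z, Arc H z j → i < z → i' ≤ z) ∨
      ((∀ z, Arc H z j → z ≤ i) ∧ ∀ z, Arc H z j → i' ≤ z)) :
    h.tree.rotW (h.edge hj hA) = h.edge hj hA' := by
  refine WBPTree.BEdge.ext ?_ rfl
  have hd : ¬ H j < H (j + 1) := not_lt.2 hA.down.le
  have hnb : ∀ z : (arcGraph n H).neighborSet ⟨j, hj⟩, Arc H z.1 j := fun z =>
    (mem_neighborSet_of_not_up (v := ⟨j, hj⟩) hd).1 z.2
  refine congrArg Subtype.val (h.tree_rot ⟨j, hj⟩ ⟨(⟨i, hA.1.trans hj⟩ : Fin (n + 1)), Or.inr hA⟩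
    ⟨(⟨i', hA'.1.trans hj⟩ : Fin (n + 1)), Or.inr hA'⟩ ?_)
  exact hii.imp (fun h' => ⟨h'.1, fun z hz => h'.2 _ (hnb z) hz⟩)
    (fun h' => ⟨fun z => h'.1 _ (hnb z), fun z => h'.2 _ (hnb z)⟩)

theorem rotB_edge (h : IsExcursion n H) {i j j' : ℕ} (hj : j < n + 1) (hj' : j' < n + 1)
    (hA : Arc H i j) (hA' : Arc H i j')
    (hjj : (j < j' ∧ ∀ z, z ≤ n → Arc H i z → j < z → j' ≤ z) ∨
      ((∀ z, z ≤ n → Arc H i z → z ≤ j) ∧ ∀ z, z ≤ n → Arc H i z → j' ≤ z)) :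
    h.tree.rotB (h.edge hj hA) = h.edge hj' hA' := by
  refine WBPTree.BEdge.ext rfl ?_
  have hi := hA.1.trans hj
  have hnb : ∀ z : (arcGraph n H).neighborSet ⟨i, hi⟩, Arc H i z.1 := fun z =>
    (mem_neighborSet_of_up (v := ⟨i, hi⟩) hA.up).1 z.2
  refine congrArg Subtype.val (h.tree_rot ⟨i, hi⟩ ⟨(⟨j, hj⟩ : Fin (n + 1)), Or.inl hA⟩
    ⟨(⟨j', hj'⟩ : Fin (n + 1)), Or.inl hA'⟩ ?_)
  exact hjj.imp
    (fun h' => ⟨h'.1, fun z hz => h'.2 _ (Nat.le_of_lt_succ z.1.isLt) (hnb z) hz⟩)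
    (fun h' => ⟨fun z => h'.1 _ (Nat.le_of_lt_succ z.1.isLt) (hnb z),
      fun z => h'.2 _ (Nat.le_of_lt_succ z.1.isLt) (hnb z)⟩)

/-- Between abscissas `k + 1` and `k + 2` the path makes one step, so the two arcs are linked by an
arc having step `k + 1` as one end. This is the intermediate edge after `rotW`. -/
theorem contour_edge (h : IsExcursion n H) {k i j i' j' : ℕ} (hk : k + 1 < n) (hj : j < n + 1)
    (hj' : j' < n + 1) (hA : ArcAt H k i j) (hA' : ArcAt H (k + 1) i' j') :
    h.tree.contour (h.edge hj hA.1) = h.edge hj' hA'.1 := by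
  have hinj : ∀ m, k + 1 < m → m ≤ n → H (k + 1) ≠ H m := fun m h1 h2 heq => by
    have := h.inj (k + 1) m (by omega) (by omega) (by omega) h2 heq
    omega
  have hinj' : ∀ m, 1 ≤ m → m ≤ k + 1 → H (k + 2) ≠ H m := fun m h1 h2 heq => by
    have := h.inj (k + 2) m (by omega) (by omega) (by omega) (by omega) heq
    omega
  rw [WBPTree.contour, Equiv.Perm.mul_apply]
  by_cases hup : H (k + 1) < H (k + 2)
  · obtain rfl : i' = k + 1 := left_eq_of_up hup hA'
    obtain ⟨hAr, hik, hkj, hmin⟩ := hA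
    have hkj' : k + 1 < j := by
      by_contra hlt
      obtain rfl : j = k + 1 := by omega
      exact absurd hAr.down (not_lt.2 hup.le)
    -- On an up-step `rotW` moves to the next left end of `j`, then `rotB` wraps around from the
    -- farthest partner of step `k + 1` to the nearest.
    have hB : Arc H (k + 1) j := ⟨hkj', fun m h1 h2 =>
      ⟨lt_of_le_of_ne (hmin m (by omega) h2) (hinj m h1 (by omega)), (hAr.2 m (by omega) h2).2⟩⟩
    rw [h.rotW_edge hj hAr hB (Or.inl ⟨by omega, ?_⟩), h.rotB_edge hj hj' hB hA'.1 (Or.inr ⟨?_, ?_⟩)]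
    · intro z hz hzA
      by_contra hlt
      exact absurd (hAr.2 (k + 1) (by omega) (by omega)).2
        (not_lt.2 (hzA.2 (j + 1) (by omega) (by omega)).1.le)
    · intro z hz hzA
      by_contra hlt
      have := hzA.1
      exact absurd (hA'.2.2.2 (z + 1) (by omega) (by omega))
        (not_le.2 (hzA.2 (k + 2) (by omega) (by omega)).2)
    · intro z hzA hz
      by_contra hlt
      exact absurd (hmin z hz (by omega)) (not_le.2 (hzA.2 (k + 1) (by omega) (by omega)).1)
  · have hdown : H (k + 2) < H (k + 1) :=
      lt_of_le_of_ne (not_lt.1 hup) (hinj' (k + 1) (by omega) le_rfl)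
    obtain rfl : j = k + 1 := right_eq_of_down hdown hA
    obtain ⟨hAr, hik, hkj, hmin⟩ := hA'
    have hik' : i' < k + 1 := by
      by_contra hlt
      obtain rfl : i' = k + 1 := by omega
      exact absurd hAr.up (not_lt.2 hdown.le)
    -- On a down-step the wrap-around occurs at the white vertex, from the nearest partner of step
    -- `k + 1` to the farthest.
    have hB : Arc H i' (k + 1) := ⟨hik', fun m h1 h2 =>
      ⟨(hAr.2 m h1 (by omega)).1, lt_of_le_of_ne (hmin m h1 (by omega)) (hinj' m (by omega) h2)⟩⟩
    rw [h.rotW_edge hj hA.1 hB (Or.inr ⟨?_, ?_⟩), h.rotB_edge hj hj' hB hAr (Or.inl ⟨hkj, ?_⟩)]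
    · intro z hz hzA hkz
      by_contra hlt
      exact absurd (hmin (z + 1) (by omega) (by omega))
        (not_le.2 (hzA.2 (k + 2) (by omega) (by omega)).2)
    · intro z hzA
      by_contra hlt
      have := hzA.1
      exact absurd (hA.2.2.2 z (by omega) (by omega))
        (not_le.2 (hzA.2 (k + 1) (by omega) (by omega)).1)
    · intro z hzA
      by_contra hlt
      exact absurd (hzA.2 i' (by omega) (by omega)).2
        (not_lt.2 (hAr.2 (k + 2) (by omega) (by omega)).1.le)

theorem exists_walk_eq_edge (h : IsExcursion n H) : ∃ e : h.tree.BEdge, ∀ k < n,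
    ∃ i j, ∃ (hj : j < n + 1) (hA : ArcAt H k i j), WBPTree.walk e k = h.edge hj hA.1 := by
  obtain ⟨i₀, j₀, hj₀, hA₀⟩ := h.exists_arcAt h.n_pos
  refine ⟨h.edge (Nat.lt_succ_of_le hj₀) hA₀.1, fun k => ?_⟩
  induction k with
  | zero => exact fun _ => ⟨i₀, j₀, _, hA₀, rfl⟩
  | succ k ih =>
    intro hk
    obtain ⟨i, j, hj, hA, hw⟩ := ih (by omega)
    obtain ⟨i', j', hj', hA'⟩ := h.exists_arcAt hk
    exact ⟨i', j', Nat.lt_succ_of_le hj', hA', by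
      rw [WBPTree.walk_succ, hw, h.contour_edge hk hj (Nat.lt_succ_of_le hj') hA hA']⟩

end IsExcursion

/-! ### The labeled tree realizing a given excursion. -/

namespace Passport

variable {S : Type*} [Fintype S] {Ξ : Passport S}

/-- The k-th contour edge is the arc at `k`. An arc starting at `i` is met no earlier than index
`i`, where an arc starting at `i` does occur; an arc ending at `j` is met no later than `j - 1`,
where one ending at `j` occurs. `pos_unique` then applies. -/
theorem exists_tree_of_excursion (hfull : Ξ.IsFull) {n : ℕ} {H : ℕ → ℝ} (h : IsExcursion n H)
    (P : Fin (n + 1) ≃ S) (hP : ∀ v, Ξ.wt (P v) = H (v + 1) - H v) :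
    ∃ (T : LWBPTree Ξ) (e : T.BEdge),
      contourPos n (T.blackCode e) (T.whiteCode e) = fun s => (P.symm s).val := by
  have hn : Fintype.card S - 1 = n := by
    have := Fintype.card_congr P
    rw [Fintype.card_fin] at this
    omega
  let T : LWBPTree Ξ :=
    { h.tree with
      lab := P
      lab_surjective := P.surjective
      wt_lab := fun v => (hP v).trans (h.tree_vertexWeight v).symm
      card_fiber := fun s => by
        rw [hfull, Nat.card_eq_one_iff_unique]
        exact ⟨⟨fun a b => Subtype.ext (P.injective (a.2.trans b.2.symm))⟩,
          ⟨P.symm s, P.apply_symm_apply s⟩⟩ }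
  obtain ⟨e, he⟩ := h.exists_walk_eq_edge
  refine ⟨T, e, ?_⟩
  have hcode := T.contourCode hfull e
  rw [hn] at hcode
  have hb : ∀ k < n, ∃ i j, ∃ hi : i < n + 1, ∃ hj : j < n + 1, ArcAt H k i j ∧
      T.blackCode e k = P ⟨i, hi⟩ ∧ T.whiteCode e k = P ⟨j, hj⟩ := by
    intro k hk
    obtain ⟨i, j, hj, hA, hw⟩ := he k hk
    refine ⟨i, j, hA.1.1.trans hj, hj, hA, ?_, ?_⟩
    · exact congrArg (fun f : h.tree.BEdge => P f.b) hw
    · exact congrArg (fun f : h.tree.BEdge => P f.w) hw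
  refine hcode.pos_unique _ ?_ ?_ ?_ ?_
  · intro k hk
    obtain ⟨i, j, hi, hj, hA, h1, h2⟩ := hb k hk
    rw [h1, Equiv.symm_apply_apply]
    exact hA.2.1
  · intro k hk
    obtain ⟨i, j, hi, hj, hA, h1, h2⟩ := hb k hk
    rw [h1, Equiv.symm_apply_apply]
    have hin : i < n := lt_of_le_of_lt hA.2.1 hk
    obtain ⟨i', j', hi', hj', hA', h1', h2'⟩ := hb i hin
    refine ⟨hin, ?_⟩
    rw [h1']
    congr 2
    exact IsExcursion.left_eq_of_up hA.1.up hA'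
  · intro k hk
    obtain ⟨i, j, hi, hj, hA, h1, h2⟩ := hb k hk
    rw [h2, Equiv.symm_apply_apply]
    exact hA.2.2.1
  · intro k hk
    obtain ⟨i, j, hi, hj, hA, h1, h2⟩ := hb k hk
    rw [h2, Equiv.symm_apply_apply]
    have hin : j - 1 < n := by have := hA.2.2.1; omega
    obtain ⟨i', j', hi', hj', hA', h1', h2'⟩ := hb (j - 1) hin
    refine ⟨hin, ?_⟩
    rw [h2']
    congr 2
    have hd := hA.1.down
    have hj1 : j - 1 + 1 = j := by have := hA.2.2.1; omega
    rw [← hj1] at hd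
    have := IsExcursion.right_eq_of_down hd hA'
    omega

end Passport

end

/-! ### Consequences of non-decomposability for cumulative sums. -/

noncomputable section

namespace Passport

variable {S : Type*} [Fintype S] {Ξ : Passport S}

theorem sum_wt (hfull : Ξ.IsFull) : ∑ s, Ξ.wt s = 0 := by
  have h := Ξ.sum_eq_zero
  simpa [hfull _] using h

theorem one_lt_card (hfull : Ξ.IsFull) : 1 < Fintype.card S := by
  have := Ξ.nonempty
  by_contra hlt
  have h1 : Fintype.card S = 1 := le_antisymm (not_lt.1 hlt) Fintype.card_pos
  obtain ⟨s, hs⟩ := Fintype.card_eq_one_iff.1 h1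
  have h2 := sum_wt hfull
  rw [Finset.sum_eq_single s (fun b _ hb => absurd (hs b) hb)
    (fun h => absurd (Finset.mem_univ s) h)] at h2
  exact Ξ.wt_ne_zero s h2

theorem size_eq_card (hfull : Ξ.IsFull) : Ξ.size = Fintype.card S := by
  classical
  rw [size, numBlack, numWhite, ← Finset.sum_union]
  · rw [← Finset.filter_or, Finset.filter_true_of_mem]
    · simp [hfull _]
    · exact fun s _ => (Ξ.wt_ne_zero s).symm.lt_or_gt
  · exact Finset.disjoint_filter.2 fun s _ h => not_lt.2 (le_of_lt h)

theorem sum_ne_zero_of_isNonDecomposable [DecidableEq S] (hfull : Ξ.IsFull)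
    (hnd : Ξ.IsNonDecomposable) {A : Finset S} (hA : A.Nonempty) (hA' : A ≠ Finset.univ) :
    ∑ s ∈ A, Ξ.wt s ≠ 0 := by
  intro h0
  have hc : Aᶜ.Nonempty := by
    rw [Finset.nonempty_iff_ne_empty]
    exact fun h => hA' ((Finset.compl_eq_empty_iff A).1 h)
  have h0' : ∑ s ∈ Aᶜ, Ξ.wt s = 0 := by
    have h1 := Finset.sum_add_sum_compl A Ξ.wt
    rw [sum_wt hfull, h0] at h1
    linarith
  -- A proper zero-sum subset and its complement would form a second partition of the passport.
  let Q : Finpartition (Finset.univ : Finset S) :=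
    (Finpartition.indiscrete hA.ne_empty).extend hc.ne_empty disjoint_compl_right
      (by simp)
  have hparts : ∀ B ∈ Q.parts, B = Aᶜ ∨ B = A := by
    intro B hB
    simpa [Q] using hB
  have hQ : Q ∈ Ξ.partitions := by
    classical
    rw [partitions, Finset.mem_filter]
    refine ⟨Finset.mem_univ _, fun B hB => ?_⟩
    rcases hparts B hB with rfl | rfl
    · simpa [hfull _] using h0'
    · simpa [hfull _] using h0
  rw [hnd, Finset.mem_singleton] at hQ
  have hAQ : A ∈ Q.parts := by simp [Q]
  rw [hQ] at hAQ
  exact hA' (by simpa [trivialPartition] using hAQ)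

theorem cumSum_zero (P : Ξ.Permutation) : Ξ.cumSum P 0 = 0 := by
  simp [cumSum]

theorem cumSum_card (hfull : Ξ.IsFull) (P : Ξ.Permutation) :
    Ξ.cumSum P (Fintype.card S) = 0 := by
  rw [cumSum, Finset.filter_true_of_mem fun j _ => j.isLt, Equiv.sum_comp P Ξ.wt, sum_wt hfull]

/-- Equal cumulative sums enclose a block of total weight zero, which must be all of `S`. -/
theorem cumSum_injective [DecidableEq S] (hfull : Ξ.IsFull) (hnd : Ξ.IsNonDecomposable)
    (P : Ξ.Permutation) {k l : ℕ} (hkl : k < l) (hl : l ≤ Fintype.card S)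
    (h : Ξ.cumSum P k = Ξ.cumSum P l) : k = 0 ∧ l = Fintype.card S := by
  by_contra hcon
  set A : Finset (Fin (Fintype.card S)) := Finset.univ.filter fun j => k ≤ j.val ∧ j.val < l
    with hA
  have hsum : Ξ.cumSum P l = Ξ.cumSum P k + ∑ j ∈ A, Ξ.wt (P j) := by
    rw [cumSum, cumSum, ← Finset.sum_union]
    · congr 1
      ext j
      simp only [hA, Finset.mem_union, Finset.mem_filter, Finset.mem_univ, true_and]
      omega
    · refine Finset.disjoint_filter.2 fun j _ h1 h2 => ?_
      omega
  have h1 := sum_ne_zero_of_isNonDecomposable hfull hnd (A := A.map P.toEmbedding) ?_ ?_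
  · rw [Finset.sum_map] at h1
    apply h1
    change ∑ j ∈ A, Ξ.wt (P j) = 0
    linarith
  · rw [Finset.map_nonempty]
    exact ⟨⟨k, by omega⟩, by simp [hA, hkl]⟩
  · intro huniv
    have hmem : ∀ j : Fin (Fintype.card S), k ≤ j.val ∧ j.val < l := by
      intro j
      have : P j ∈ A.map P.toEmbedding := huniv ▸ Finset.mem_univ _
      simpa [hA] using this
    have h2 := one_lt_card hfull
    have h3 := hmem ⟨0, by omega⟩
    have h4 := hmem ⟨Fintype.card S - 1, by omega⟩
    simp only at h3 h4
    omega

/-- A coincidence of cumulative sums can only be between the two ends, where the value is zero; the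
conditions at positive and negative levels are therefore vacuous. -/
theorem isTreePermutation_of_isNonDecomposable [DecidableEq S] (hfull : Ξ.IsFull)
    (hnd : Ξ.IsNonDecomposable) (P : Ξ.Permutation) : Ξ.IsTreePermutation P := by
  refine ⟨fun i h1 h2 h0 => ?_, fun k l hk hkl hl h h' => ?_, fun k l hk hkl hl h h' => ?_⟩
  · have := one_lt_card hfull
    have := cumSum_injective hfull hnd P (k := 0) (l := i) (by omega) (by omega)
      (by rw [cumSum_zero, h0])
    omega
  · rw [(cumSum_injective hfull hnd P (by omega) hl h).2, cumSum_card hfull] at h'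
    exact absurd h' (lt_irrefl _)
  · rw [(cumSum_injective hfull hnd P (by omega) hl h).2, cumSum_card hfull] at h'
    exact absurd h' (lt_irrefl _)

/-! ### The cycle lemma. -/

variable (Ξ) in
/-- The orders all of whose proper partial sums are positive. -/
def PositiveOrder : Type _ :=
  {P : Ξ.Permutation // ∀ i, 1 ≤ i → i < Fintype.card S → 0 < Ξ.cumSum P i}

section Rotation

variable [NeZero (Fintype.card S)]

variable (Ξ) in
/-- The cumulative sums, extended periodically. -/
def periodicSum (P : Fin (Fintype.card S) ≃ S) (m : ℕ) : ℝ :=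
  ∑ j ∈ Finset.range m, Ξ.wt (P (Fin.ofNat (Fintype.card S) j))

theorem periodicSum_eq (P : Ξ.Permutation) {i : ℕ} (hi : i ≤ Fintype.card S) :
    Ξ.periodicSum P i = Ξ.cumSum P i := by
  rw [periodicSum, cumSum]
  refine Finset.sum_bij' (fun j _ => Fin.ofNat _ j) (fun j _ => j.val) ?_ ?_ ?_ ?_ ?_
  · intro j hj
    rw [Finset.mem_range] at hj
    simp [Nat.mod_eq_of_lt (show j < Fintype.card S by omega), hj]
  · intro j hj; simpa using hj
  · intro j hj
    rw [Finset.mem_range] at hj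
    simp [Nat.mod_eq_of_lt (show j < Fintype.card S by omega)]
  · intro j hj; simp
  · intro j hj; rfl

theorem periodicSum_add_card (hfull : Ξ.IsFull) (P : Ξ.Permutation) (m : ℕ) :
    Ξ.periodicSum P (m + Fintype.card S) = Ξ.periodicSum P m := by
  rw [add_comm, periodicSum, Finset.sum_range_add]
  have h1 := periodicSum_eq P le_rfl
  rw [cumSum_card hfull, periodicSum] at h1
  rw [h1, zero_add, periodicSum]
  refine Finset.sum_congr rfl fun j _ => ?_
  congr 2
  ext
  simp

theorem periodicSum_rotate (P : Ξ.Permutation) (k : Fin (Fintype.card S)) (i : ℕ) :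
    Ξ.periodicSum ((Equiv.addRight k).trans P) i =
      Ξ.periodicSum P (k + i) - Ξ.periodicSum P k := by
  have h : Ξ.periodicSum P (k + i) = Ξ.periodicSum P k +
      ∑ j ∈ Finset.range i, Ξ.wt (P (Fin.ofNat (Fintype.card S) (k + j))) :=
    Finset.sum_range_add _ _ _
  rw [h, add_sub_cancel_left, periodicSum]
  refine Finset.sum_congr rfl fun j _ => ?_
  congr 1
  change P (Fin.ofNat _ j + k) = _
  congr 1
  ext
  simp [Fin.val_add, add_comm]

theorem periodicSum_nonneg (hfull : Ξ.IsFull) (P : Ξ.PositiveOrder) (m : ℕ) :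
    0 ≤ Ξ.periodicSum P.1 m ∧ (Ξ.periodicSum P.1 m = 0 → Fintype.card S ∣ m) := by
  induction m using Nat.strong_induction_on with
  | _ m ih =>
    by_cases hm : m < Fintype.card S
    · rw [periodicSum_eq _ hm.le]
      rcases Nat.eq_zero_or_pos m with rfl | h0
      · simp [cumSum_zero]
      · have := P.2 m h0 hm
        exact ⟨this.le, fun h => absurd h this.ne'⟩
    · have h1 := periodicSum_add_card hfull P.1 (m - Fintype.card S)
      rw [Nat.sub_add_cancel (not_lt.1 hm)] at h1
      have hN : 0 < Fintype.card S := Nat.pos_of_ne_zero (NeZero.ne _)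
      have h2 := ih (m - Fintype.card S) (by omega)
      rw [h1]
      refine ⟨h2.1, fun h => ?_⟩
      exact (Nat.dvd_sub_iff_left (not_lt.1 hm) dvd_rfl).1 (h2.2 h)

/-- A rotation has positive proper sums exactly when it starts at the minimum of the periodic path,
and that minimum is unique within a period. -/
theorem rotate_bijective [DecidableEq S] (hfull : Ξ.IsFull) (hnd : Ξ.IsNonDecomposable) :
    Function.Bijective fun x : Ξ.PositiveOrder × Fin (Fintype.card S) =>
      ((Equiv.addRight x.2).trans x.1.1 : Fin (Fintype.card S) ≃ S) := by
  constructor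
  · rintro ⟨P, k⟩ ⟨P', k'⟩ h
    have h : (Equiv.addRight k).trans P.1 = (Equiv.addRight k').trans P'.1 := h
    have hk : k = k' := by
      have e : ∀ i, Ξ.periodicSum P.1 (k + i) - Ξ.periodicSum P.1 k =
          Ξ.periodicSum P'.1 (k' + i) - Ξ.periodicSum P'.1 k' := fun i => by
        rw [← periodicSum_rotate, ← periodicSum_rotate, h]
      have z : ∀ Q : Ξ.PositiveOrder, Ξ.periodicSum Q.1 (Fintype.card S) = 0 := fun Q => by
        rw [periodicSum_eq _ le_rfl, cumSum_card hfull]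
      -- Completing the period once in `P` and once in `P'` yields two values that are negatives of
      -- each other; both are nonnegative, so both vanish.
      have e1 := e (Fintype.card S - k)
      have e2 := e (Fintype.card S - k')
      rw [show k.val + (Fintype.card S - k) = Fintype.card S by omega, z] at e1
      rw [show k'.val + (Fintype.card S - k') = Fintype.card S by omega, z] at e2
      have n1 := periodicSum_nonneg hfull P' (k' + (Fintype.card S - k))
      have n2 := periodicSum_nonneg hfull P (k + (Fintype.card S - k'))
      obtain ⟨c, hc⟩ := n1.2 (by linarith)
      have hlt := k.isLt
      have hlt' := k'.isLt
      have hc0 : 0 < c := by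
        rcases Nat.eq_zero_or_pos c with rfl | h
        · omega
        · exact h
      have hc1 : c < 2 := by
        by_contra hge
        have := Nat.mul_le_mul_left (Fintype.card S) (not_lt.1 hge)
        omega
      obtain rfl : c = 1 := by omega
      exact Fin.ext (by omega)
    subst hk
    refine Prod.ext (Subtype.ext (Equiv.ext fun i => ?_)) rfl
    have := Equiv.congr_fun h (i - k)
    simpa using this
  · intro Q
    have hN : 0 < Fintype.card S := Nat.pos_of_ne_zero (NeZero.ne _)
    obtain ⟨m, hm, hmin⟩ := Finset.exists_min_image (Finset.range (Fintype.card S))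
      (Ξ.periodicSum Q) ⟨0, by simpa using hN⟩
    rw [Finset.mem_range] at hm
    have hlt : ∀ a < Fintype.card S, a ≠ m → Ξ.periodicSum Q m < Ξ.periodicSum Q a := by
      intro a ha ham
      refine lt_of_le_of_ne (hmin a (Finset.mem_range.2 ha)) fun heq => ?_
      rw [periodicSum_eq _ hm.le, periodicSum_eq _ ha.le] at heq
      rcases Nat.lt_or_gt_of_ne ham with h | h
      · have := (cumSum_injective hfull hnd Q h hm.le heq.symm).2
        omega
      · have := (cumSum_injective hfull hnd Q h ha.le heq).2
        omega
    -- Start `Q` at its minimum; rotating by `-m` undoes this.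
    refine ⟨⟨⟨(Equiv.addRight (⟨m, hm⟩ : Fin (Fintype.card S))).trans Q, ?_⟩, -⟨m, hm⟩⟩, ?_⟩
    · intro i h1 h2
      rw [← periodicSum_eq _ h2.le, periodicSum_rotate, sub_pos]
      change Ξ.periodicSum Q m < Ξ.periodicSum Q (m + i)
      by_cases hmi : m + i < Fintype.card S
      · exact hlt _ hmi (by omega)
      · have := periodicSum_add_card hfull Q (m + i - Fintype.card S)
        rw [Nat.sub_add_cancel (not_lt.1 hmi)] at this
        rw [this]
        exact hlt _ (by omega) (by omega)
    · refine Equiv.ext fun i => ?_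
      simp

end Rotation

theorem card_positiveOrder [DecidableEq S] (hfull : Ξ.IsFull) (hnd : Ξ.IsNonDecomposable) :
    Nat.card Ξ.PositiveOrder = (Fintype.card S - 1).factorial := by
  have hN := one_lt_card hfull
  have : NeZero (Fintype.card S) := ⟨by omega⟩
  have h := Nat.card_congr (Equiv.ofBijective _ (rotate_bijective hfull hnd))
  rw [Nat.card_prod, Nat.card_eq_fintype_card (α := Fin _), Fintype.card_fin,
    Nat.card_eq_fintype_card (α := Fin _ ≃ S),
    Fintype.card_equiv (Fintype.equivFin S).symm, Fintype.card_fin,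
    ← Nat.mul_factorial_pred (by omega), mul_comm] at h
  exact Nat.eq_of_mul_eq_mul_left (by omega) h

/-! ### Marked trees correspond to positive orders. -/

namespace LWBPTree

/-- The order in which the contour, starting at `e`, lists the vertices. -/
def order (hfull : Ξ.IsFull) (T : LWBPTree Ξ) (e : T.BEdge) : Ξ.Permutation :=
  (Equiv.ofBijective (fun s => (⟨contourPos (Fintype.card S - 1) (T.blackCode e) (T.whiteCode e) s,
      by
        have := (T.contourCode hfull e).pos_le s
        have := one_lt_card hfull
        omega⟩ : Fin (Fintype.card S)))
    ((Fintype.bijective_iff_injective_and_card _).2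
      ⟨fun s t hst => (T.contourCode hfull e).pos_injective (congrArg Fin.val hst),
        (Fintype.card_fin _).symm⟩)).symm

theorem order_symm_val (hfull : Ξ.IsFull) (T : LWBPTree Ξ) (e : T.BEdge) (s : S) :
    ((T.order hfull e).symm s).val =
      contourPos (Fintype.card S - 1) (T.blackCode e) (T.whiteCode e) s := rfl

theorem cumSum_order (hfull : Ξ.IsFull) (T : LWBPTree Ξ) (e : T.BEdge) (i : ℕ) :
    Ξ.cumSum (T.order hfull e) i = ContourCode.partialSum Ξ.wt
      (contourPos (Fintype.card S - 1) (T.blackCode e) (T.whiteCode e)) i := by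
  rw [cumSum, ContourCode.partialSum]
  refine Finset.sum_equiv (T.order hfull e) (fun j => ?_) fun _ _ => rfl
  rw [Finset.mem_filter, Finset.mem_filter, ← order_symm_val hfull, Equiv.symm_apply_apply]
  simp

/-- The contour order of a tree has positive proper partial sums. -/
def positiveOrder (hfull : Ξ.IsFull) (T : LWBPTree Ξ) (e : T.BEdge) : Ξ.PositiveOrder :=
  ⟨T.order hfull e, fun i h1 h2 => by
    rw [cumSum_order]
    have := (T.contourCode hfull e).partialSum_pos (T.isFlow hfull e) (k := i - 1) (by omega)
    rwa [show i - 1 + 1 = i by omega] at this⟩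

theorem positiveOrder_eq_iff (hfull : Ξ.IsFull) (T : LWBPTree Ξ) (e : T.BEdge)
    (P : Ξ.PositiveOrder) : T.positiveOrder hfull e = P ↔
      contourPos (Fintype.card S - 1) (T.blackCode e) (T.whiteCode e) =
        fun s => (P.1.symm s).val := by
  constructor
  · rintro rfl
    rfl
  · intro h
    apply Subtype.ext
    apply Equiv.symm_bijective.injective
    refine Equiv.ext fun s => Fin.ext ?_
    exact congrFun h s

end LWBPTree

theorem isExcursion_cumSum [DecidableEq S] (hfull : Ξ.IsFull) (hnd : Ξ.IsNonDecomposable)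
    (P : Ξ.PositiveOrder) : IsExcursion (Fintype.card S - 1) (Ξ.cumSum P.1) := by
  have hN := one_lt_card hfull
  refine ⟨by omega, cumSum_zero _, ?_, fun k h1 h2 => P.2 k h1 (by omega), ?_⟩
  · rw [show Fintype.card S - 1 + 1 = Fintype.card S by omega, cumSum_card hfull]
  · intro a b ha ha' hb hb' hab
    rcases lt_trichotomy a b with h | h | h
    · have := cumSum_injective hfull hnd P.1 h (by omega) hab
      omega
    · exact h
    · have := cumSum_injective hfull hnd P.1 h (by omega) hab.symm
      omega

theorem cumSum_succ (P : Ξ.Permutation) (v : Fin (Fintype.card S)) :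
    Ξ.cumSum P (v + 1) = Ξ.cumSum P v + Ξ.wt (P v) := by
  rw [add_comm (Ξ.cumSum P v), cumSum, cumSum, ← Finset.sum_insert (f := fun j => Ξ.wt (P j)) (by simp)]
  congr 1
  ext j
  simp only [Finset.mem_filter, Finset.mem_univ, true_and, Finset.mem_insert, Fin.ext_iff]
  omega

theorem exists_positiveOrder_eq [DecidableEq S] (hfull : Ξ.IsFull) (hnd : Ξ.IsNonDecomposable)
    (P : Ξ.PositiveOrder) : ∃ (T : LWBPTree Ξ) (e : T.BEdge), T.positiveOrder hfull e = P := by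
  have hN := one_lt_card hfull
  have hN' : Fintype.card S - 1 + 1 = Fintype.card S := by omega
  obtain ⟨T, e, h⟩ := exists_tree_of_excursion hfull (isExcursion_cumSum hfull hnd P)
    ((finCongr hN').trans P.1) (fun v => by
      have := cumSum_succ P.1 (finCongr hN' v)
      exact eq_sub_of_add_eq' this.symm)
  exact ⟨T, e, (T.positiveOrder_eq_iff hfull e P).2 h⟩

/-- Equal orders give equal codes, hence isomorphic trees, and then the same chosen representative.
The marks agree too, since an edge is determined by the labels of its ends. Surjectivity is the
strip construction, carried to the representative by an isomorphism. -/
theorem markedTree_bijective [DecidableEq S] (hfull : Ξ.IsFull) (hnd : Ξ.IsNonDecomposable) :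
    Function.Bijective fun x : (Σ T : Ξ.Tree, (Quotient.out T).BEdge) =>
      (Quotient.out x.1).positiveOrder hfull x.2 := by
  constructor
  · rintro ⟨T, e⟩ ⟨T', e'⟩ h
    have hpos := (LWBPTree.positiveOrder_eq_iff hfull _ _ _).1 h
    have hb := fun k hk => ContourCode.black_eq_of_pos_eq (LWBPTree.contourCode hfull _ e)
      (LWBPTree.contourCode hfull _ e') (LWBPTree.isFlow hfull _ e) (LWBPTree.isFlow hfull _ e')
      hpos (k := k) hk
    have hw := fun k hk => ContourCode.white_eq_of_pos_eq (LWBPTree.contourCode hfull _ e)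
      (LWBPTree.contourCode hfull _ e') (LWBPTree.isFlow hfull _ e) (LWBPTree.isFlow hfull _ e')
      hpos (k := k) hk
    obtain rfl : T = T' := by
      rw [← Quotient.out_eq T, ← Quotient.out_eq T']
      exact Quotient.sound (LWBPTree.isomorphic_of_code_eq hfull hb hw)
    have h0 : 0 < Fintype.card S - 1 := by have := one_lt_card hfull; omega
    have hinj := (LWBPTree.lab_bijective hfull (Quotient.out T)).1
    rw [show e = e' from WBPTree.BEdge.ext (hinj (hb 0 h0)) (hinj (hw 0 h0))]
  · intro P
    obtain ⟨T, e, hP⟩ := exists_positiveOrder_eq hfull hnd P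
    obtain ⟨e', hb, hw⟩ := LWBPTree.exists_code_eq_of_isomorphic
      ((LWBPTree.isomorphic_equivalence Ξ).symm
        (Quotient.exact (Quotient.out_eq (Quotient.mk _ T : Ξ.Tree)))) e
    refine ⟨⟨Quotient.mk _ T, e'⟩, ?_⟩
    rw [← hP, LWBPTree.positiveOrder_eq_iff, hb, hw]
    rfl

/-- Double counting of marked trees: every tree has N - 1 edges, and there are (N - 1)! positive
orders. -/
theorem card_tree [DecidableEq S] (hfull : Ξ.IsFull) (hnd : Ξ.IsNonDecomposable) :
    Nat.card Ξ.Tree = (Fintype.card S - 2).factorial := by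
  have hN := one_lt_card hfull
  have hE : ∀ T : Ξ.Tree, Nonempty ((Quotient.out T).BEdge ≃ Fin (Fintype.card S - 1)) := fun T =>
    ⟨Finite.equivFinOfCardEq (LWBPTree.card_bEdge hfull _)⟩
  have h := Nat.card_congr (Equiv.ofBijective _ (markedTree_bijective hfull hnd))
  rw [Nat.card_congr (Equiv.sigmaEquivProdOfEquiv fun T => (hE T).some), Nat.card_prod,
    Nat.card_eq_fintype_card (α := Fin _), Fintype.card_fin, card_positiveOrder hfull hnd,
    ← Nat.mul_factorial_pred (by omega), mul_comm] at h
  exact Nat.eq_of_mul_eq_mul_left (by omega) h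

end Passport

end

theorem corollary2p10 {S : Type*} [Fintype S] [DecidableEq S] (Ξ : Passport S)
    (hfull : Ξ.IsFull) (hnd : Ξ.IsNonDecomposable) :
    (∀ P : Ξ.Permutation, Ξ.IsTreePermutation P) ∧
    (Nat.card Ξ.Tree : ℚ) =
      ∑ 𝔭 ∈ Ξ.partitions,
        (-1 : ℚ) ^ ((𝔭.parts.card : ℤ) - 1) * ((Ξ.size : ℚ) - 1) ^ ((𝔭.parts.card : ℤ) - 2) *
          (Passport.X 𝔭 : ℚ) ∧
    Nat.card Ξ.Tree = (Ξ.size - 2).factorial := by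
  have hN := Passport.one_lt_card hfull
  have hcard := Passport.card_tree hfull hnd
  rw [Passport.size_eq_card hfull]
  refine ⟨Passport.isTreePermutation_of_isNonDecomposable hfull hnd, ?_, hcard⟩
  -- Only the one-part partition remains; its exponent 1 - 2 = -1 turns (N - 1)! into (N - 2)!.
  rw [hnd, Finset.sum_singleton, hcard]
  have hparts : Ξ.trivialPartition.parts = {Finset.univ} := rfl
  have hne : (Fintype.card S : ℚ) - 1 ≠ 0 := by
    have : (1 : ℚ) < Fintype.card S := by exact_mod_cast hN
    linarith
  have hfac : ((Fintype.card S - 1).factorial : ℚ) =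
      ((Fintype.card S : ℚ) - 1) * (Fintype.card S - 2).factorial := by
    rw [← Nat.mul_factorial_pred (n := Fintype.card S - 1) (by omega)]
    push_cast [Nat.cast_sub hN.le]
    rfl
  rw [Passport.X, hparts, Finset.prod_singleton, Finset.card_singleton, Finset.card_univ, hfac]
  norm_num
  field_simp
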